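/- Let $G=(V,E)$ be a finite connected graph with $|V|\ge 2$. In the social network model on $G$, at time $0$ each vertex $v$ holds $N_v$ walkers, where $(N_v)_{v\in V}$ are independent, $N_v\sim\mathrm{Poisson}(|V|\pi_v)$ and $\pi_v=d_v/(2|E|)$ with $d_v$ the degree of $v$. All walkers then perform simultaneously, in discrete time, independent lazy simple random walks on $G$: a walker at $v$ stays put with probability $1/2$ and moves to each neighbour of $v$ with probability $1/(2d_v)$; let $P$ be the transition matrix. Two walkers have met by time $t$ if they are at the same vertex at the same time $t_0$ for some $t_0\le t$. Two walkers $a,b$ have a path of acquaintances by time $t$ if there are walkers $a=c_0,c_1,\dots,c_{k+1}=b$ such that $c_i$ and $c_{i+1}$ have met by time $t$ for all $0\le i\le k$. The social connectivity time $\mathrm{SC}(G)$ is the least $t\in\{0,1,2,\dots\}$ such that every pair of walkers has a path of acquaintances by time $t$ (and $\infty$ if there is no such $t$). **Theorem.** There exist absolute constants $c,C>0$ such that for every finite connected regular graph $G=(V,E)$ with $|V|\ge 2$, $$\mathbb{P}\bigl[\mathrm{SC}(G)<\log|V|-6\log\log|V|\bigr]\le \frac{C}{\log|V|}$$ and $$\mathbb{P}\bigl[\mathrm{SC}(G)<s_*(G)\bigr]\le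 C\exp\bigl(-c\sqrt{|V|}\,(\log|V|)^{-4}\bigr),$$ where $$\kappa_t:=\min_{v\in V}\sum_{i=0}^{t}P^{2i}(v,v)\qquad\text{and}\qquad s_*(G):=\min\Bigl\{t\in\{0,1,2,\dots\}:\ \frac{t+1}{\kappa_{t+1}}>\frac1{32}\log|V|\Bigr\}.$$ -/

import Mathlib

open MeasureTheory ProbabilityTheory
open scoped ENNReal NNReal

noncomputable section

namespace SocialNetwork

variable {V : Type*} [Fintype V] [DecidableEq V]

/-- Transition matrix of the lazy simple random walk on `G`: from `x` stay put with probability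
`1/2`, and move to each neighbour of `x` with probability `1/(2 d_x)`.
(At a vertex without neighbours, which never occurs in a connected graph with at least two
vertices, the walk stays put.) -/
def lazyWalk (G : SimpleGraph V) [DecidableRel G.Adj] : Matrix V V ℝ := fun x y =>
  if x = y then (if G.degree x = 0 then 1 else 1 / 2)
  else if G.Adj x y then 1 / (2 * (G.degree x : ℝ))
  else 0

theorem lazyWalk_nonneg (G : SimpleGraph V) [DecidableRel G.Adj] (x y : V) :
    0 ≤ lazyWalk G x y := by
  unfold lazyWalk
  split_ifs <;> positivity

theorem lazyWalk_sum (G : SimpleGraph V) [DecidableRel G.Adj] (x : V) :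
    ∑ y, lazyWalk G x y = 1 := by
  have h : ∀ y, lazyWalk G x y =
      (if x = y then (if G.degree x = 0 then (1 : ℝ) else 1 / 2) else 0) +
        (if G.Adj x y then 1 / (2 * (G.degree x : ℝ)) else 0) := by
    intro y
    unfold lazyWalk
    by_cases hxy : x = y
    · subst hxy; simp
    · simp [hxy]
  simp only [h, Finset.sum_add_distrib, Finset.sum_ite_eq, Finset.mem_univ, if_true]
  rw [← Finset.sum_filter, Finset.sum_const, ← G.neighborFinset_eq_filter,
    G.card_neighborFinset_eq_degree, nsmul_eq_mul]
  by_cases hd : G.degree x = 0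
  · simp [hd]
  · have : (G.degree x : ℝ) ≠ 0 := by exact_mod_cast hd
    simp only [hd, if_false]
    field_simp
    norm_num

/-- The law of the position after one step of the lazy simple random walk from `x`. -/
def stepPMF (G : SimpleGraph V) [DecidableRel G.Adj] (x : V) : PMF V :=
  PMF.ofFintype (fun y => ENNReal.ofReal (lazyWalk G x y)) (by
    rw [← ENNReal.ofReal_sum_of_nonneg (fun y _ => lazyWalk_nonneg G x y), lazyWalk_sum,
      ENNReal.ofReal_one])

variable [MeasurableSpace V] [DiscreteMeasurableSpace V]

/-- The one-step transition kernel of the lazy simple random walk. -/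
def stepKernel (G : SimpleGraph V) [DecidableRel G.Adj] : Kernel V V where
  toFun x := (stepPMF G x).toMeasure
  measurable' := Measurable.of_discrete

instance (G : SimpleGraph V) [DecidableRel G.Adj] : IsMarkovKernel (stepKernel G) :=
  ⟨fun x => inferInstanceAs (IsProbabilityMeasure (stepPMF G x).toMeasure)⟩

/-- The same kernel, as a function of the whole trajectory up to time `n`. -/
def historyKernel (G : SimpleGraph V) [DecidableRel G.Adj] (n : ℕ) :
    Kernel ((i : Finset.Iic n) → V) V :=
  (stepKernel G).comap (fun h => h ⟨n, Finset.mem_Iic.2 le_rfl⟩) (measurable_pi_apply _)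

instance (G : SimpleGraph V) [DecidableRel G.Adj] (n : ℕ) :
    IsMarkovKernel (historyKernel G n) := by
  unfold historyKernel; infer_instance

/-- The law, on trajectories `ℕ → V`, of the lazy simple random walk on `G` started at `v`. -/
def walkLaw (G : SimpleGraph V) [DecidableRel G.Adj] (v : V) : Measure (ℕ → V) :=
  Kernel.traj (X := fun _ => V) (historyKernel G) 0 (fun _ => v)

instance (G : SimpleGraph V) [DecidableRel G.Adj] (v : V) :
    IsProbabilityMeasure (walkLaw G v) := by
  unfold walkLaw; infer_instance

/-- `|V| π_v`, where `π_v = d_v / (2|E|)` is the stationary distribution. -/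
def meanWalkers {V : Type*} [Fintype V] (G : SimpleGraph V) [DecidableRel G.Adj] (v : V) : ℝ≥0 :=
  (Fintype.card V : ℝ≥0) * ((G.degree v : ℝ≥0) / (2 * (G.edgeFinset.card : ℝ≥0)))

/-- Labels of potential walkers: `(v, k)` is the `k`-th walker starting at `v`. -/
abbrev Label (V : Type*) := V × ℕ

/-- A configuration: the number of walkers at each vertex at time `0`, and for each label the
trajectory of the corresponding potential walker. -/
abbrev Config (V : Type*) := (V → ℕ) × (Label V → ℕ → V)

/-- The law of the social network model on `G`: the numbers `N_v` of walkers initially at `v` are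
independent `Poisson(|V| π_v)`, and, independently of them, all walkers perform independent lazy
simple random walks from their starting vertices. -/
def snMeasure (G : SimpleGraph V) [DecidableRel G.Adj] : Measure (Config V) :=
  (Measure.pi fun v => poissonMeasure (meanWalkers G v)).prod
    (Measure.infinitePi fun w : Label V => walkLaw G w.1)

instance (G : SimpleGraph V) [DecidableRel G.Adj] : IsProbabilityMeasure (snMeasure G) := by
  unfold snMeasure; infer_instance

/-- The walkers that are present: labels `(v, k)` with `k < N_v`. -/
def Walker {V : Type*} (ω : Config V) : Type _ := {w : Label V // w.2 < ω.1 w.1}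

/-- The position of a walker at time `s`. -/
def position {V : Type*} (ω : Config V) (a : Walker ω) (s : ℕ) : V := ω.2 a.1 s

/-- Two walkers have met by time `t`. -/
def MetBy {V : Type*} (ω : Config V) (t : ℕ) (a b : Walker ω) : Prop :=
  ∃ s ≤ t, position ω a s = position ω b s

/-- Two walkers have a path of acquaintances by time `t`: there are
`a = c_0, c_1, …, c_{k+1} = b` such that `c_i` and `c_{i+1}` have met by time `t`. -/
def AcquaintedBy {V : Type*} (ω : Config V) (t : ℕ) (a b : Walker ω) : Prop :=
  Relation.TransGen (MetBy ω t) a b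

/-- The social connectivity time: the first time by which every pair of walkers has a path of
acquaintances (`⊤` if there is no such time). -/
def socialConnectivityTime {V : Type*} (ω : Config V) : ℕ∞ :=
  sInf {T : ℕ∞ | ∃ t : ℕ, T = t ∧ ∀ a b : Walker ω, AcquaintedBy ω t a b}

/-- `κ_t`, the minimum over `v` of `∑_{i=0}^t P^{2i}(v,v)`. -/
def kappa {V : Type*} [Fintype V] [DecidableEq V] [Nonempty V] (G : SimpleGraph V)
    [DecidableRel G.Adj] (t : ℕ) : ℝ :=
  Finset.univ.inf' Finset.univ_nonempty
    (fun v : V => ∑ i ∈ Finset.range (t + 1), (lazyWalk G ^ (2 * i)) v v)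

/-- `s_*`, the least `t` with `(t+1)/κ_{t+1} > (1/32) log |V|` (`⊤` if there were none). -/
def sStar {V : Type*} [Fintype V] [DecidableEq V] [Nonempty V] (G : SimpleGraph V)
    [DecidableRel G.Adj] : ℕ∞ :=
  sInf {T : ℕ∞ | ∃ t : ℕ, T = t ∧
    ((t : ℝ) + 1) / kappa G (t + 1) > 1 / 32 * Real.log (Fintype.card V)}

end SocialNetwork

end

/-!
Fix a time `t`. By Poisson thinning (`map_pathCount_snMeasure`), the numbers of walkers following
the paths `γ` of length `t` are independent Poisson variables, whose means on a regular graph are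
the products of the transition probabilities along `γ`. A walker that meets nobody up to time `t`
occupies an *isolated* path, so if all walkers are acquainted by time `t` then there is at most one
isolated path (`card_isolated_le_one_of_acquainted`; one is possible, for a lonely walker).

Let `Z` be the number of isolated paths, and let the free mass `Q` be the total mean of the paths
that meet no walker. Adding a walker on a free path creates exactly one isolated path, hence the
Mecke equation gives `(j + 1) P(Z = j + 1) = E[Q; Z = j]`. So if `Q ≥ q` apart from an event of
probability `δ`, then `P(Z ≤ 1) ≤ 4 δ + 6 · 2 ^ (-q / 2)` (`isolated_card_le_one`), and it remains
to show that `E Q` is large and that `Q` is rarely below half its mean.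

* Concentration. A walker can meet paths of total mean at most `K = t + 1`, and `Q` depends only on
  the set of occupied paths, whose mean size is at most `n = |V|`. This gives `Var Q ≤ K² E Q`, and
  by bounded differences a lower tail `exp (-(E Q)² / (16 n K²))`.
* Mean. `E Q` is the sum over `γ` of the mean of `γ` times `exp (-m γ)`, with `m γ` the total mean
  of the paths that meet `γ`. Since `m γ ≤ t + 1`, we have `E Q ≥ n exp (-(t + 1))`, which exceeds
  a constant times `(log n)⁶` before time `log n - 6 log log n`. Alternatively, by Jensen's
  inequality one may average `m`: two independent walks that meet have on average at least `κ`
  further meetings, so the average of `m` is at most `2 (t + 1) / κ_{t + 1}`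
  (`sum_pathWeight_meetNbhd_le`), which is at most `(log n) / 16` before time `s_*`; hence
  `E Q ≥ n ^ (15 / 16)`.
* Length of the time interval. For the second bound `K` must be polylogarithmic. Before `s_*` the
  return probabilities are at least of order `1 / log n` on average, and as long as they are so
  large, they drop by a fixed power of `1 / log n` at each step (`return_drop`); therefore
  `t + 1 ≤ (log n)⁶` (`time_le_log_pow`).
-/

noncomputable section

namespace SocialNetwork

/-! ### Random subsets with independent memberships -/

section RandomSubset

variable {I : Type*} [DecidableEq I]

/-- The expectation of `f S`, where `S` is the random subset of `U` that contains each `i ∈ U`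
independently with probability `a i`. -/
def subsetExp (a : I → ℝ) (U : Finset I) (f : Finset I → ℝ) : ℝ :=
  ∑ S ∈ U.powerset, (∏ i ∈ S, a i) * (∏ i ∈ U \ S, (1 - a i)) * f S

theorem subsetExp_empty (a : I → ℝ) (f : Finset I → ℝ) : subsetExp a ∅ f = f ∅ := by
  simp [subsetExp]

theorem subsetExp_insert (a : I → ℝ) {U : Finset I} {i : I} (hi : i ∉ U) (f : Finset I → ℝ) :
    subsetExp a (insert i U) f =
      subsetExp a U (fun S => (1 - a i) * f S + a i * f (insert i S)) := by
  unfold subsetExp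
  rw [Finset.sum_powerset_insert hi, ← Finset.sum_add_distrib]
  refine Finset.sum_congr rfl fun S hS => ?_
  have hSU := Finset.mem_powerset.1 hS
  have hiS : i ∉ S := fun h => hi (hSU h)
  have h1 : insert i U \ S = insert i (U \ S) := Finset.insert_sdiff_of_notMem _ hiS
  have h2 : insert i U \ insert i S = U \ S := by
    ext j; simp only [Finset.mem_sdiff, Finset.mem_insert]
    constructor
    · rintro ⟨h | h, h'⟩ <;> tauto
    · rintro ⟨h, h'⟩
      refine ⟨Or.inr h, ?_⟩
      rintro (rfl | h'')
      · exact hi h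
      · exact h' h''
  rw [h1, h2, Finset.prod_insert hiS, Finset.prod_insert (by simp [hi])]
  ring

theorem subsetExp_const (a : I → ℝ) (U : Finset I) (c : ℝ) : subsetExp a U (fun _ => c) = c := by
  induction U using Finset.induction_on with
  | empty => simp [subsetExp_empty]
  | insert i U hi ih =>
    rw [subsetExp_insert a hi]
    have h : (fun _ : Finset I => (1 - a i) * c + a i * c) = fun _ => c := by ext; ring
    rw [h, ih]

theorem subsetExp_add (a : I → ℝ) (U : Finset I) (f g : Finset I → ℝ) :
    subsetExp a U (fun S => f S + g S) = subsetExp a U f + subsetExp a U g := by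
  simp [subsetExp, mul_add, Finset.sum_add_distrib]

theorem subsetExp_const_mul (a : I → ℝ) (U : Finset I) (c : ℝ) (f : Finset I → ℝ) :
    subsetExp a U (fun S => c * f S) = c * subsetExp a U f := by
  simp only [subsetExp, Finset.mul_sum]
  exact Finset.sum_congr rfl fun S _ => by ring

theorem subsetExp_sum {ι : Type*} (a : I → ℝ) (U : Finset I) (s : Finset ι)
    (f : ι → Finset I → ℝ) :
    subsetExp a U (fun S => ∑ j ∈ s, f j S) = ∑ j ∈ s, subsetExp a U (f j) := by
  simp only [subsetExp, Finset.mul_sum]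
  exact Finset.sum_comm

theorem subsetExp_mono {a : I → ℝ} (h0 : ∀ i, 0 ≤ a i) (h1 : ∀ i, a i ≤ 1) (U : Finset I)
    {f g : Finset I → ℝ} (h : ∀ S, f S ≤ g S) : subsetExp a U f ≤ subsetExp a U g :=
  Finset.sum_le_sum fun S _ => mul_le_mul_of_nonneg_left (h S) <|
    mul_nonneg (Finset.prod_nonneg fun i _ => h0 i)
      (Finset.prod_nonneg fun i _ => sub_nonneg.2 (h1 i))

theorem subsetExp_disjoint (a : I → ℝ) (U T : Finset I) :
    subsetExp a U (fun S => if Disjoint S T then 1 else 0) = ∏ i ∈ U ∩ T, (1 - a i) := by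
  induction U using Finset.induction_on with
  | empty => simp [subsetExp_empty]
  | insert i U hi ih =>
    rw [subsetExp_insert a hi]
    by_cases hT : i ∈ T
    · rw [Finset.insert_inter_of_mem hT, Finset.prod_insert (by simp [hi]), ← ih,
        ← subsetExp_const_mul]
      congr 1; ext S; simp [hT]
    · rw [Finset.insert_inter_of_notMem hT, ← ih]
      congr 1; ext S
      simp only [Finset.disjoint_insert_left, hT, not_false_eq_true, true_and]
      ring

/-- The case of one coordinate in `subsetExp_laplace`, where `x` and `y` are the values without and
with the element, which is present with probability `q`. -/
theorem bernoulli_laplace {q x y K l : ℝ} (hq0 : 0 ≤ q) (hxy : 0 ≤ x - y)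
    (hK : x - y ≤ K) (hl : 0 ≤ l) (hlK : l * K ≤ 1) :
    (1 - q) * Real.exp (-l * x) + q * Real.exp (-l * y) ≤
      Real.exp (-l * ((1 - q) * x + q * y) + l ^ 2 * K ^ 2 * q) := by
  set θ := l * (x - y) with hθ
  have hθ0 : 0 ≤ θ := mul_nonneg hl hxy
  have hθK : θ ≤ l * K := mul_le_mul_of_nonneg_left hK hl
  have hθ1 : θ ≤ 1 := hθK.trans hlK
  have hexp : Real.exp θ ≤ 1 + θ + θ ^ 2 := by
    have := Real.abs_exp_sub_one_sub_id_le (x := θ) (by rw [abs_of_nonneg hθ0]; exact hθ1)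
    linarith [(abs_le.1 this).2]
  have h1 : (1 - q) * Real.exp (-l * x) + q * Real.exp (-l * y) =
      Real.exp (-l * x) * (1 + q * (Real.exp θ - 1)) := by
    have : Real.exp (-l * y) = Real.exp (-l * x) * Real.exp θ := by
      rw [← Real.exp_add]; congr 1; rw [hθ]; ring
    rw [this]; ring
  rw [h1]
  have h2 : 1 + q * (Real.exp θ - 1) ≤ Real.exp (q * θ + q * (l * K) ^ 2) := by
    calc 1 + q * (Real.exp θ - 1) ≤ q * (Real.exp θ - 1) + 1 := by linarith
      _ ≤ q * (θ + (l * K) ^ 2) + 1 := by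
        have : θ ^ 2 ≤ (l * K) ^ 2 := pow_le_pow_left₀ hθ0 hθK 2
        gcongr; linarith
      _ ≤ Real.exp (q * (θ + (l * K) ^ 2)) := Real.add_one_le_exp _
      _ = _ := by rw [mul_add]
  calc _ ≤ Real.exp (-l * x) * Real.exp (q * θ + q * (l * K) ^ 2) := by gcongr
    _ = _ := by rw [← Real.exp_add]; congr 1; rw [hθ]; ring

/-- Laplace transform bound for a decreasing function of a random subset that drops by at most `K`
when an element is added. The variance proxy is the expected number of elements, not the number of
coordinates. -/
theorem subsetExp_laplace {a : I → ℝ} (h0 : ∀ i, 0 ≤ a i) (h1 : ∀ i, a i ≤ 1) (U : Finset I)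
    {K l : ℝ} (hl : 0 ≤ l) (hlK : l * K ≤ 1) (f : Finset I → ℝ)
    (hf : ∀ S i, 0 ≤ f S - f (insert i S) ∧ f S - f (insert i S) ≤ K) :
    subsetExp a U (fun S => Real.exp (-l * f S)) ≤
      Real.exp (-l * subsetExp a U f + l ^ 2 * K ^ 2 * ∑ i ∈ U, a i) := by
  induction U using Finset.induction_on generalizing f with
  | empty => simp [subsetExp_empty]
  | insert i U hi ih =>
    rw [subsetExp_insert a hi, subsetExp_insert a hi, Finset.sum_insert hi]
    set g : Finset I → ℝ := fun S => (1 - a i) * f S + a i * f (insert i S) with hg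
    have hgl : ∀ S j, 0 ≤ g S - g (insert j S) ∧ g S - g (insert j S) ≤ K := by
      intro S j
      have e : g S - g (insert j S) = (1 - a i) * (f S - f (insert j S)) +
          a i * (f (insert i S) - f (insert j (insert i S))) := by
        simp only [hg]; rw [Finset.insert_comm i j S]; ring
      rw [e]
      have b1 := hf S j
      have b2 := hf (insert i S) j
      have := h0 i
      have := h1 i
      constructor
      · exact add_nonneg (mul_nonneg (by linarith) b1.1) (mul_nonneg (by linarith) b2.1)
      · calc _ ≤ (1 - a i) * K + a i * K := by
              exact add_le_add (mul_le_mul_of_nonneg_left b1.2 (by linarith))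
                (mul_le_mul_of_nonneg_left b2.2 (by linarith))
          _ = K := by ring
    calc _ ≤ subsetExp a U (fun S => Real.exp (l ^ 2 * K ^ 2 * a i) * Real.exp (-l * g S)) := by
          refine subsetExp_mono h0 h1 U fun S => ?_
          have := bernoulli_laplace (h0 i) (hf S i).1 (hf S i).2 hl hlK
          rw [← Real.exp_add]
          refine this.trans (le_of_eq ?_)
          congr 1; simp only [hg]; ring
      _ ≤ Real.exp (l ^ 2 * K ^ 2 * a i) *
            Real.exp (-l * subsetExp a U g + l ^ 2 * K ^ 2 * ∑ i ∈ U, a i) := by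
          rw [subsetExp_const_mul]
          gcongr
          exact ih g hgl
      _ = _ := by rw [← Real.exp_add]; congr 1; ring

end RandomSubset

/-! ### The free mass -/

section FreeMass

/-- The probability that a Poisson variable with mean `p i` is positive. -/
def occProb {I : Type*} (p : I → ℝ≥0) (i : I) : ℝ := 1 - Real.exp (-(p i : ℝ))

theorem occProb_nonneg {I : Type*} (p : I → ℝ≥0) (i : I) : 0 ≤ occProb p i := by
  have : Real.exp (-(p i : ℝ)) ≤ 1 := Real.exp_le_one_iff.2 (by simp)
  unfold occProb; linarith

theorem occProb_le_one {I : Type*} (p : I → ℝ≥0) (i : I) : occProb p i ≤ 1 := by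
  unfold occProb; linarith [Real.exp_pos (-(p i : ℝ))]

theorem occProb_le {I : Type*} (p : I → ℝ≥0) (i : I) : occProb p i ≤ p i := by
  have := Real.add_one_le_exp (-(p i : ℝ))
  unfold occProb; linarith

variable {I : Type*} [Fintype I] [DecidableEq I]

/-- The total intensity of the points `γ` none of whose neighbours `N γ` is occupied, `S` being the
set of occupied points. -/
def freeMass (p : I → ℝ≥0) (N : I → Finset I) (S : Finset I) : ℝ :=
  ∑ γ, (p γ : ℝ) * (if Disjoint S (N γ) then 1 else 0)

/-- The expectation of `freeMass` when the points are occupied according to independent Poisson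
numbers with means `p`. -/
def meanFreeMass {I : Type*} [Fintype I] (p : I → ℝ≥0) (N : I → Finset I) : ℝ :=
  ∑ γ, (p γ : ℝ) * Real.exp (-∑ η ∈ N γ, (p η : ℝ))

theorem meanFreeMass_nonneg {I : Type*} [Fintype I] (p : I → ℝ≥0) (N : I → Finset I) :
    0 ≤ meanFreeMass p N :=
  Finset.sum_nonneg fun _ _ => by positivity

theorem meanFreeMass_le {I : Type*} [Fintype I] (p : I → ℝ≥0) (N : I → Finset I) :
    meanFreeMass p N ≤ ∑ γ, (p γ : ℝ) := by
  refine Finset.sum_le_sum fun γ _ => ?_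
  have : Real.exp (-∑ η ∈ N γ, (p η : ℝ)) ≤ 1 :=
    Real.exp_le_one_iff.2 (neg_nonpos.2 (Finset.sum_nonneg fun _ _ => by positivity))
  nlinarith [(p γ).2]

variable (p : I → ℝ≥0) (N : I → Finset I)

theorem subsetExp_occ_disjoint (T : Finset I) :
    subsetExp (occProb p) Finset.univ (fun S => if Disjoint S T then 1 else 0) =
      Real.exp (-∑ i ∈ T, (p i : ℝ)) := by
  rw [subsetExp_disjoint, Finset.univ_inter, ← Finset.sum_neg_distrib, Real.exp_sum]
  simp [occProb]

theorem subsetExp_freeMass :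
    subsetExp (occProb p) Finset.univ (freeMass p N) = meanFreeMass p N := by
  unfold freeMass meanFreeMass
  rw [subsetExp_sum]
  simp_rw [subsetExp_const_mul, subsetExp_occ_disjoint]

variable {p N}

theorem freeMass_sub_insert (hsymm : ∀ γ η, η ∈ N γ → γ ∈ N η) {K : ℝ}
    (hK : ∀ γ, ∑ η ∈ N γ, (p η : ℝ) ≤ K) (S : Finset I) (i : I) :
    0 ≤ freeMass p N S - freeMass p N (insert i S) ∧
      freeMass p N S - freeMass p N (insert i S) ≤ K := by
  unfold freeMass
  rw [← Finset.sum_sub_distrib]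
  constructor
  · refine Finset.sum_nonneg fun γ _ => ?_
    rw [← mul_sub]
    refine mul_nonneg (p γ).2 ?_
    simp only [Finset.disjoint_insert_left]
    split_ifs <;> simp_all
  · refine le_trans ?_ (hK i)
    rw [← Finset.sum_subset (Finset.subset_univ (N i))]
    · refine Finset.sum_le_sum fun γ _ => ?_
      rw [← mul_sub]
      refine mul_le_of_le_one_right (p γ).2 ?_
      split_ifs <;> norm_num
    · intro γ _ hγ
      have : i ∉ N γ := fun h => hγ (hsymm _ _ h)
      simp [Finset.disjoint_insert_left, this]

/-- Markov's inequality for events about random subsets. -/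
theorem subsetExp_indicator_le (A : Finset I → Prop) [DecidablePred A] (g : Finset I → ℝ)
    (hg0 : ∀ S, 0 ≤ g S) (hg : ∀ S, A S → 1 ≤ g S) :
    subsetExp (occProb p) Finset.univ (fun S => if A S then 1 else 0) ≤
      subsetExp (occProb p) Finset.univ g := by
  refine subsetExp_mono (occProb_nonneg p) (occProb_le_one p) _ fun S => ?_
  split_ifs with h
  · exact hg S h
  · exact hg0 S

/-- Lower tail of the free mass by bounded differences. -/
theorem freeMass_lower_tail_exp (hsymm : ∀ γ η, η ∈ N γ → γ ∈ N η) {K n : ℝ} (hK1 : 1 ≤ K)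
    (hK : ∀ γ, ∑ η ∈ N γ, (p η : ℝ) ≤ K) (hn : ∑ γ, (p γ : ℝ) = n) (hn0 : 0 < n) :
    subsetExp (occProb p) Finset.univ
        (fun S => if freeMass p N S < meanFreeMass p N / 2 then 1 else 0) ≤
      Real.exp (-(meanFreeMass p N ^ 2 / (16 * n * K ^ 2))) := by
  set μ := meanFreeMass p N with hμ
  have hμ0 : 0 ≤ μ := meanFreeMass_nonneg p N
  have hμn : μ ≤ n := hn ▸ meanFreeMass_le p N
  -- the exponent `-l μ / 2 + l² K² n` is minimal at this value
  set l := μ / (4 * n * K ^ 2) with hldef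
  have hK0 : 0 < K := by linarith
  have hl : 0 ≤ l := by positivity
  have hlK : l * K ≤ 1 := by
    have : l * K = μ / (4 * n * K) := by rw [hldef]; field_simp
    rw [this, div_le_one (by positivity)]
    nlinarith
  calc _ ≤ subsetExp (occProb p) Finset.univ
        (fun S => Real.exp (l * (μ / 2)) * Real.exp (-l * freeMass p N S)) := by
        refine subsetExp_indicator_le _ _ (fun S => by positivity) fun S hS => ?_
        rw [← Real.exp_add]
        refine Real.one_le_exp ?_
        nlinarith
    _ ≤ Real.exp (l * (μ / 2)) * Real.exp (-l * μ + l ^ 2 * K ^ 2 * n) := by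
        rw [subsetExp_const_mul]
        gcongr
        refine (subsetExp_laplace (occProb_nonneg p) (occProb_le_one p) _ hl hlK _
          (freeMass_sub_insert hsymm hK)).trans ?_
        rw [subsetExp_freeMass, ← hn]
        gcongr with i
        exact occProb_le p i
    _ = _ := by
        rw [← Real.exp_add]; congr 1; rw [hldef]; field_simp; ring

theorem subsetExp_freeMass_sq :
    subsetExp (occProb p) Finset.univ (fun S => freeMass p N S ^ 2) =
      ∑ γ, ∑ η, (p γ : ℝ) * p η * Real.exp (-∑ i ∈ N γ ∪ N η, (p i : ℝ)) := by
  have : (fun S => freeMass p N S ^ 2) = fun S => ∑ γ, ∑ η,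
      ((p γ : ℝ) * p η) * (if Disjoint S (N γ ∪ N η) then 1 else 0) := by
    ext S
    rw [freeMass, sq, Finset.sum_mul_sum]
    refine Finset.sum_congr rfl fun γ _ => Finset.sum_congr rfl fun η _ => ?_
    simp only [Finset.disjoint_union_right]
    by_cases h1 : Disjoint S (N γ) <;> by_cases h2 : Disjoint S (N η) <;> simp [h1, h2]
  rw [this, subsetExp_sum]
  simp_rw [subsetExp_sum, subsetExp_const_mul, subsetExp_occ_disjoint]

/-- The covariance of the events that `γ` and `η` are free is at most the probability that `γ` is
free times the mass of their common neighbours. -/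
theorem variance_freeMass_le (hsymm : ∀ γ η, η ∈ N γ → γ ∈ N η) {K : ℝ} (hK0 : 0 ≤ K)
    (hK : ∀ γ, ∑ η ∈ N γ, (p η : ℝ) ≤ K) :
    subsetExp (occProb p) Finset.univ (fun S => (freeMass p N S - meanFreeMass p N) ^ 2) ≤
      K ^ 2 * meanFreeMass p N := by
  set μ := meanFreeMass p N with hμ
  have h1 : (fun S => (freeMass p N S - μ) ^ 2) =
      fun S => freeMass p N S ^ 2 + ((-(2 * μ)) * freeMass p N S + μ ^ 2) := by
    ext S; ring
  rw [h1, subsetExp_add, subsetExp_add, subsetExp_const_mul, subsetExp_const,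
    subsetExp_freeMass, subsetExp_freeMass_sq, ← hμ]
  have h2 : μ ^ 2 = ∑ γ, ∑ η, (p γ : ℝ) * p η *
      Real.exp (-(∑ i ∈ N γ, (p i : ℝ)) - ∑ i ∈ N η, (p i : ℝ)) := by
    rw [hμ, meanFreeMass, sq, Finset.sum_mul_sum]
    refine Finset.sum_congr rfl fun γ _ => Finset.sum_congr rfl fun η _ => ?_
    rw [sub_eq_add_neg, Real.exp_add]; ring
  have h3 : ∀ γ η, Real.exp (-∑ i ∈ N γ ∪ N η, (p i : ℝ)) -
      Real.exp (-(∑ i ∈ N γ, (p i : ℝ)) - ∑ i ∈ N η, (p i : ℝ)) ≤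
      Real.exp (-∑ i ∈ N γ, (p i : ℝ)) * ∑ i ∈ N γ ∩ N η, (p i : ℝ) := by
    intro γ η
    have e := Finset.sum_union_inter (s₁ := N γ) (s₂ := N η) (f := fun i => (p i : ℝ))
    have le1 : ∑ i ∈ N γ, (p i : ℝ) ≤ ∑ i ∈ N γ ∪ N η, (p i : ℝ) :=
      Finset.sum_le_sum_of_subset_of_nonneg Finset.subset_union_left fun i _ _ => (p i).2
    have e2 : Real.exp (-(∑ i ∈ N γ, (p i : ℝ)) - ∑ i ∈ N η, (p i : ℝ)) =
        Real.exp (-∑ i ∈ N γ ∪ N η, (p i : ℝ)) * Real.exp (-∑ i ∈ N γ ∩ N η, (p i : ℝ)) := by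
      rw [← Real.exp_add]; congr 1; linarith
    rw [e2]
    have h4 := Real.add_one_le_exp (-∑ i ∈ N γ ∩ N η, (p i : ℝ))
    calc _ = Real.exp (-∑ i ∈ N γ ∪ N η, (p i : ℝ)) *
          (1 - Real.exp (-∑ i ∈ N γ ∩ N η, (p i : ℝ))) := by ring
      _ ≤ Real.exp (-∑ i ∈ N γ ∪ N η, (p i : ℝ)) * ∑ i ∈ N γ ∩ N η, (p i : ℝ) := by
        gcongr; linarith
      _ ≤ _ := by gcongr
  have h5 : ∀ γ, ∑ η, (p η : ℝ) * ∑ i ∈ N γ ∩ N η, (p i : ℝ) ≤ K ^ 2 := by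
    intro γ
    calc ∑ η, (p η : ℝ) * ∑ i ∈ N γ ∩ N η, (p i : ℝ)
        = ∑ η, ∑ i ∈ N γ, (if i ∈ N η then (p η : ℝ) * p i else 0) := by
          refine Finset.sum_congr rfl fun η _ => ?_
          rw [Finset.mul_sum, ← Finset.sum_filter, Finset.filter_mem_eq_inter]
      _ = ∑ i ∈ N γ, (p i : ℝ) * ∑ η ∈ N i, (p η : ℝ) := by
          rw [Finset.sum_comm]
          refine Finset.sum_congr rfl fun i _ => ?_
          rw [Finset.mul_sum, ← Finset.sum_filter]
          refine Finset.sum_congr ?_ fun η _ => mul_comm _ _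
          ext η; simp only [Finset.mem_filter, Finset.mem_univ, true_and]
          exact ⟨hsymm _ _, hsymm _ _⟩
      _ ≤ ∑ i ∈ N γ, (p i : ℝ) * K := by
          gcongr with i; exact hK i
      _ ≤ K ^ 2 := by
          rw [← Finset.sum_mul, sq]; gcongr; exact hK γ
  calc _ = (∑ γ, ∑ η, (p γ : ℝ) * p η * Real.exp (-∑ i ∈ N γ ∪ N η, (p i : ℝ))) - μ ^ 2 := by ring
    _ = ∑ γ, ∑ η, (p γ : ℝ) * p η * (Real.exp (-∑ i ∈ N γ ∪ N η, (p i : ℝ)) -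
      Real.exp (-(∑ i ∈ N γ, (p i : ℝ)) - ∑ i ∈ N η, (p i : ℝ))) := by
        rw [h2, ← Finset.sum_sub_distrib]
        simp_rw [← Finset.sum_sub_distrib, mul_sub]
    _ ≤ ∑ γ, ∑ η, (p γ : ℝ) * p η * (Real.exp (-∑ i ∈ N γ, (p i : ℝ)) *
          ∑ i ∈ N γ ∩ N η, (p i : ℝ)) := by
        gcongr with γ _ η _; exact h3 γ η
    _ = ∑ γ, (p γ : ℝ) * Real.exp (-∑ i ∈ N γ, (p i : ℝ)) *
          ∑ η, (p η : ℝ) * ∑ i ∈ N γ ∩ N η, (p i : ℝ) := by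
        refine Finset.sum_congr rfl fun γ _ => ?_
        rw [Finset.mul_sum]
        exact Finset.sum_congr rfl fun η _ => by ring
    _ ≤ ∑ γ, (p γ : ℝ) * Real.exp (-∑ i ∈ N γ, (p i : ℝ)) * K ^ 2 := by
        gcongr with γ _; exact h5 γ
    _ = _ := by rw [← Finset.sum_mul, hμ, meanFreeMass, mul_comm]

/-- Lower tail of the free mass by Chebyshev's inequality. -/
theorem freeMass_lower_tail_variance (hsymm : ∀ γ η, η ∈ N γ → γ ∈ N η) {K : ℝ} (hK0 : 0 ≤ K)
    (hK : ∀ γ, ∑ η ∈ N γ, (p η : ℝ) ≤ K) (hμ0 : 0 < meanFreeMass p N) :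
    subsetExp (occProb p) Finset.univ
        (fun S => if freeMass p N S < meanFreeMass p N / 2 then 1 else 0) ≤
      4 * K ^ 2 / meanFreeMass p N := by
  set μ := meanFreeMass p N with hμ
  calc _ ≤ subsetExp (occProb p) Finset.univ
        (fun S => (4 / μ ^ 2) * (freeMass p N S - μ) ^ 2) := by
        refine subsetExp_indicator_le _ _ (fun S => by positivity) fun S hS => ?_
        rw [div_mul_eq_mul_div, le_div_iff₀ (by positivity)]
        nlinarith
    _ ≤ (4 / μ ^ 2) * (K ^ 2 * μ) := by
        rw [subsetExp_const_mul]
        gcongr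
        exact variance_freeMass_le hsymm hK0 hK
    _ = _ := by field_simp

end FreeMass

/-! ### Isolated points of a Poisson configuration -/

section Counts

variable {I : Type*} [Fintype I]

/-- The law of independent Poisson numbers with means `p`. -/
def countLaw (p : I → ℝ≥0) : Measure (I → ℕ) := Measure.pi fun i => poissonMeasure (p i)

instance (p : I → ℝ≥0) : IsProbabilityMeasure (countLaw p) := by
  unfold countLaw; infer_instance

/-- The set of occupied points. -/
def occupied (c : I → ℕ) : Finset I := Finset.univ.filter fun i => c i ≠ 0

theorem sum_mul_measureReal {Ω : Type*} [MeasurableSpace Ω] (μ : Measure Ω) [IsFiniteMeasure μ]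
    (w : I → ℝ) (A : I → Set Ω) (hA : ∀ i, MeasurableSet (A i)) :
    ∑ i, w i * μ.real (A i) = ∫ x, ∑ i, w i * (A i).indicator 1 x ∂μ := by
  rw [integral_finsetSum]
  · refine Finset.sum_congr rfl fun i _ => ?_
    rw [integral_const_mul, integral_indicator_one (hA i)]
  · intro i _
    exact ((integrable_const (1 : ℝ)).indicator (hA i)).const_mul _

variable [DecidableEq I]

/-- The points that are occupied exactly once and have no other occupied neighbour. -/
def isolated (N : I → Finset I) (c : I → ℕ) : Finset I :=
  Finset.univ.filter fun γ => c γ = 1 ∧ ∀ η ∈ N γ, η ≠ γ → c η = 0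

theorem countLaw_occupied (p : I → ℝ≥0) (A : Finset I → Prop) [DecidablePred A] :
    (countLaw p).real {c | A (occupied c)} =
      subsetExp (occProb p) Finset.univ (fun S => if A S then 1 else 0) := by
  have h1 : {c : I → ℕ | A (occupied c)} =
      ⋃ S ∈ (Finset.univ : Finset (Finset I)).filter A, {c | occupied c = S} := by
    ext c; simp
  have h2 : ∀ S : Finset I, (countLaw p).real {c | occupied c = S} =
      (∏ i ∈ S, occProb p i) * ∏ i ∈ Finset.univ \ S, (1 - occProb p i) := by
    intro S
    have e : {c : I → ℕ | occupied c = S} =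
        Set.pi Set.univ fun i => if i ∈ S then ({0}ᶜ : Set ℕ) else {0} := by
      ext c
      simp only [Set.mem_ofPred_eq, Set.mem_univ_pi, Finset.ext_iff, occupied, Finset.mem_filter,
        Finset.mem_univ, true_and]
      refine forall_congr' fun i => ?_
      by_cases hi : i ∈ S <;> simp [hi]
    have z : ∀ i, (poissonMeasure (p i)).real {0} = Real.exp (-(p i : ℝ)) := by
      intro i; rw [poissonMeasure_real_singleton]; simp
    rw [e, countLaw, measureReal_def, Measure.pi_pi, ENNReal.toReal_prod,
      ← Finset.prod_mul_prod_compl S, Finset.compl_eq_univ_sdiff]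
    congr 1
    · refine Finset.prod_congr rfl fun i hi => ?_
      rw [if_pos hi, ← measureReal_def, probReal_compl_eq_one_sub (measurableSet_singleton 0), z,
        occProb]
    · refine Finset.prod_congr rfl fun i hi => ?_
      rw [if_neg (Finset.mem_sdiff.1 hi).2, ← measureReal_def, z, occProb]
      ring
  rw [h1, measureReal_biUnion_finset]
  · unfold subsetExp
    rw [Finset.powerset_univ, Finset.sum_filter]
    refine Finset.sum_congr rfl fun S _ => ?_
    rw [h2]; split_ifs with hS <;> simp [hS]
  · intro S _ T _ hST
    refine Set.disjoint_left.2 fun c hc hc' => hST ?_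
    exact hc.symm.trans hc'
  · intro S _; exact MeasurableSet.of_discrete

/-- The Mecke equation for a point occupied exactly once: such a point can be added to the
configuration at the price of its intensity. -/
theorem countLaw_add_point (p : I → ℝ≥0) (γ : I) (A : Set (I → ℕ)) :
    (countLaw p).real {c | c γ = 1 ∧ c ∈ A} =
      p γ * (countLaw p).real {c | c γ = 0 ∧ Function.update c γ 1 ∈ A} := by
  have key : (countLaw p).restrict {c | c γ = 1} =
      (p γ : ℝ≥0∞) • ((countLaw p).restrict {c | c γ = 0}).map (fun c => Function.update c γ 1) := by
    refine Measure.ext_of_singleton fun c => ?_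
    rw [Measure.restrict_apply (measurableSet_singleton c), Measure.smul_apply,
      Measure.map_apply Measurable.of_discrete (measurableSet_singleton c),
      Measure.restrict_apply MeasurableSet.of_discrete]
    by_cases hc : c γ = 1
    · have e1 : ({c} : Set (I → ℕ)) ∩ {c | c γ = 1} = {c} := by
        ext d; simp only [Set.mem_inter_iff, Set.mem_singleton_iff, Set.mem_ofPred_eq]
        exact ⟨fun h => h.1, fun h => ⟨h, h ▸ hc⟩⟩
      have e2 : (fun c : I → ℕ => Function.update c γ 1) ⁻¹' {c} ∩ {c | c γ = 0} =
          {Function.update c γ 0} := by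
        ext d
        simp only [Set.mem_inter_iff, Set.mem_preimage, Set.mem_singleton_iff, Set.mem_ofPred_eq]
        constructor
        · rintro ⟨rfl, h⟩
          rw [Function.update_idem, ← h, Function.update_eq_self]
        · rintro rfl
          refine ⟨?_, by simp⟩
          rw [Function.update_idem, ← hc, Function.update_eq_self]
      rw [e1, e2, countLaw, Measure.pi_singleton, Measure.pi_singleton,
        ← Finset.mul_prod_erase _ _ (Finset.mem_univ γ),
        ← Finset.mul_prod_erase (a := γ) _ (fun i => poissonMeasure (p i) {Function.update c γ 0 i})
          (Finset.mem_univ γ), smul_eq_mul, ← mul_assoc]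
      congr 1
      · simp only [hc, Function.update_self, poissonMeasure_singleton]
        rw [← ENNReal.ofReal_coe_nnreal, ← ENNReal.ofReal_mul (by positivity)]
        congr 1; simp; ring
      · refine Finset.prod_congr rfl fun i hi => ?_
        rw [Function.update_of_ne (Finset.ne_of_mem_erase hi)]
    · have e1 : ({c} : Set (I → ℕ)) ∩ {c | c γ = 1} = ∅ := by
        ext d; simp only [Set.mem_inter_iff, Set.mem_singleton_iff, Set.mem_ofPred_eq,
          Set.mem_empty_iff_false, iff_false]
        rintro ⟨rfl, h⟩; exact hc h
      have e2 : (fun c : I → ℕ => Function.update c γ 1) ⁻¹' {c} ∩ {c | c γ = 0} = ∅ := by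
        ext d
        simp only [Set.mem_inter_iff, Set.mem_preimage, Set.mem_singleton_iff, Set.mem_ofPred_eq,
          Set.mem_empty_iff_false, iff_false]
        rintro ⟨rfl, -⟩; exact hc (by simp)
      rw [e1, e2]; simp
  have h := congrArg (fun m : Measure (I → ℕ) => m.real A) key
  simp only [measureReal_def, Measure.smul_apply, smul_eq_mul, ENNReal.toReal_mul] at h
  rw [Measure.restrict_apply MeasurableSet.of_discrete,
    Measure.map_apply Measurable.of_discrete MeasurableSet.of_discrete,
    Measure.restrict_apply MeasurableSet.of_discrete] at h
  rw [measureReal_def, measureReal_def]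
  have e1 : {c : I → ℕ | c γ = 1 ∧ c ∈ A} = A ∩ {c | c γ = 1} := by
    ext c; simp [and_comm]
  have e2 : {c : I → ℕ | c γ = 0 ∧ Function.update c γ 1 ∈ A} =
      (fun c => Function.update c γ 1) ⁻¹' A ∩ {c | c γ = 0} := by
    ext c; simp [and_comm]
  rw [e1, e2]
  exact h

variable {p : I → ℝ≥0} {N : I → Finset I}

/-- Adding a point at a free place creates exactly one isolated point. -/
theorem isolated_update (hrefl : ∀ γ, γ ∈ N γ) (c : I → ℕ) (γ : I) :
    c γ = 0 ∧ γ ∈ isolated N (Function.update c γ 1) ↔ Disjoint (occupied c) (N γ) := by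
  rw [Finset.disjoint_left]
  simp only [isolated, occupied, Finset.mem_filter, Finset.mem_univ, true_and,
    Function.update_self]
  constructor
  · rintro ⟨h0, h⟩ η hη hηγ
    by_cases e : η = γ
    · exact hη (e ▸ h0)
    · have := h η hηγ e
      rw [Function.update_of_ne e] at this
      exact hη this
  · intro h
    refine ⟨by_contra fun h0 => h h0 (hrefl γ), fun η hη e => ?_⟩
    rw [Function.update_of_ne e]
    exact by_contra fun h0 => h h0 hη

theorem card_isolated_update (hrefl : ∀ γ, γ ∈ N γ) (hsymm : ∀ γ η, η ∈ N γ → γ ∈ N η)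
    (c : I → ℕ) (γ : I) (h : Disjoint (occupied c) (N γ)) :
    (isolated N (Function.update c γ 1)).card = (isolated N c).card + 1 := by
  have h' : ∀ η ∈ N γ, c η = 0 := fun η hη => by_contra fun h0 =>
    Finset.disjoint_left.1 h (Finset.mem_filter.2 ⟨Finset.mem_univ _, h0⟩) hη
  have hγ : γ ∉ isolated N c := by simp [isolated, h' γ (hrefl γ)]
  rw [← Finset.card_insert_of_notMem hγ]
  congr 1
  ext η
  simp only [isolated, Finset.mem_insert, Finset.mem_filter, Finset.mem_univ, true_and]
  by_cases e : η = γ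
  · subst e
    simp only [Function.update_self, true_and, true_or, iff_true]
    intro ζ hζ hne
    rw [Function.update_of_ne hne]; exact h' ζ hζ
  · simp only [Function.update_of_ne e, e, false_or]
    refine and_congr_right fun h1 => forall_congr' fun ζ => imp_congr_right fun hζ =>
      imp_congr_right fun hne => ?_
    have : ζ ≠ γ := by
      rintro rfl
      have := h' η (hsymm _ _ hζ); omega
    rw [Function.update_of_ne this]

/-- The Mecke equation summed over all points, `(j + 1) P(Z = j + 1) = E[Q; Z = j]` for the number
`Z` of isolated points and the free mass `Q`, with `Q` bounded below by `q` off the event `Q < q`. -/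
theorem isolated_card_recursion (hrefl : ∀ γ, γ ∈ N γ) (hsymm : ∀ γ η, η ∈ N γ → γ ∈ N η)
    {q : ℝ} (hq : 0 ≤ q) (j : ℕ) :
    q * ((countLaw p).real {c | (isolated N c).card = j} -
        (countLaw p).real {c | freeMass p N (occupied c) < q}) ≤
      (j + 1) * (countLaw p).real {c | (isolated N c).card = j + 1} := by
  set μ := countLaw p with hμ
  have hint : ∀ A : Set (I → ℕ), Integrable (A.indicator (1 : (I → ℕ) → ℝ)) μ := fun A =>
    (integrable_const (1 : ℝ)).indicator MeasurableSet.of_discrete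
  have h1 : (j + 1) * μ.real {c | (isolated N c).card = j + 1} =
      ∑ γ, 1 * μ.real {c | γ ∈ isolated N c ∧ (isolated N c).card = j + 1} := by
    rw [sum_mul_measureReal _ _ _ fun _ => MeasurableSet.of_discrete,
      ← integral_indicator_one MeasurableSet.of_discrete, ← integral_const_mul]
    congr 1; ext c
    by_cases hc : (isolated N c).card = j + 1
    · simp [hc, Set.indicator_apply]
    · simp [hc]
  have h2 : ∀ γ, μ.real {c | γ ∈ isolated N c ∧ (isolated N c).card = j + 1} =
      p γ * μ.real {c | Disjoint (occupied c) (N γ) ∧ (isolated N c).card = j} := by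
    intro γ
    have e := countLaw_add_point p γ {c | γ ∈ isolated N c ∧ (isolated N c).card = j + 1}
    have e1 : {c : I → ℕ | c γ = 1 ∧ c ∈ {c | γ ∈ isolated N c ∧ (isolated N c).card = j + 1}} =
        {c | γ ∈ isolated N c ∧ (isolated N c).card = j + 1} := by
      ext c
      simp only [Set.mem_ofPred_eq, and_iff_right_iff_imp]
      rintro ⟨h, -⟩
      exact (Finset.mem_filter.1 h).2.1
    have e2 : {c : I → ℕ | c γ = 0 ∧ Function.update c γ 1 ∈
        {c | γ ∈ isolated N c ∧ (isolated N c).card = j + 1}} =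
        {c | Disjoint (occupied c) (N γ) ∧ (isolated N c).card = j} := by
      ext c
      simp only [Set.mem_ofPred_eq]
      rw [← and_assoc, isolated_update hrefl]
      refine and_congr_right fun h => ?_
      rw [card_isolated_update hrefl hsymm c γ h]; omega
    rw [e1, e2] at e
    exact e
  rw [h1]
  simp_rw [h2, one_mul]
  rw [sum_mul_measureReal _ _ _ fun _ => MeasurableSet.of_discrete,
    ← integral_indicator_one MeasurableSet.of_discrete,
    ← integral_indicator_one MeasurableSet.of_discrete, ← integral_sub (hint _) (hint _),
    ← integral_const_mul]
  refine integral_mono (((hint _).sub (hint _)).const_mul q)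
    (integrable_finsetSum _ fun γ _ => (hint _).const_mul _) fun c => ?_
  simp only [Set.indicator_apply, Set.mem_ofPred_eq, Pi.one_apply]
  have hnn : 0 ≤ ∑ γ, (p γ : ℝ) *
      (if Disjoint (occupied c) (N γ) ∧ (isolated N c).card = j then 1 else 0) :=
    Finset.sum_nonneg fun γ _ => by positivity
  by_cases hj : (isolated N c).card = j
  · simp only [hj, and_true, if_true]
    by_cases hf : freeMass p N (occupied c) < q
    · simp only [hf, if_true, sub_self, mul_zero]
      simpa [hj] using hnn
    · rw [if_neg hf, sub_zero, mul_one]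
      simpa [hj, freeMass] using hf
  · refine le_trans ?_ hnn
    simp only [hj, if_false]
    split_ifs <;> simp [hq]

/-- If the free mass is rarely below `q`, there are rarely fewer than two isolated points: below
level `q / 2`, each value of the number of isolated points is at most half as likely as the next,
up to the probability that the free mass is below `q`. -/
theorem isolated_card_le_one (hrefl : ∀ γ, γ ∈ N γ) (hsymm : ∀ γ η, η ∈ N γ → γ ∈ N η)
    {q : ℝ} (hq : 0 < q) :
    (countLaw p).real {c | (isolated N c).card ≤ 1} ≤
      4 * (countLaw p).real {c | freeMass p N (occupied c) < q} + 6 * (2 : ℝ) ^ (-(q / 2)) := by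
  set μ := countLaw p with hμ
  set δ := μ.real {c | freeMass p N (occupied c) < q} with hδ
  set k := ⌊q / 2⌋₊ with hk
  have hkq : (k : ℝ) ≤ q / 2 := Nat.floor_le (by positivity)
  have hqk : q / 2 < k + 1 := Nat.lt_floor_add_one _
  have hδ0 : 0 ≤ δ := measureReal_nonneg
  have step : ∀ j, j + 1 ≤ k → μ.real {c | (isolated N c).card = j} ≤
      δ + (1 / 2) * μ.real {c | (isolated N c).card = j + 1} := by
    intro j hj
    have h := isolated_card_recursion (p := p) hrefl hsymm hq.le j
    have hjk : (j : ℝ) + 1 ≤ q / 2 := le_trans (by exact_mod_cast hj) hkq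
    have h' : q * (μ.real {c | (isolated N c).card = j} - δ) ≤
        q / 2 * μ.real {c | (isolated N c).card = j + 1} :=
      h.trans (mul_le_mul_of_nonneg_right hjk measureReal_nonneg)
    have : q * (μ.real {c | (isolated N c).card = j} - δ) ≤
        q * ((1 / 2) * μ.real {c | (isolated N c).card = j + 1}) := by linarith
    linarith [le_of_mul_le_mul_left this hq]
  have main : ∀ m j, j + m = k → μ.real {c | (isolated N c).card = j} ≤
      2 * δ + (1 / 2) ^ m := by
    intro m
    induction m with
    | zero => intro j _; simpa using measureReal_le_one.trans (by linarith)
    | succ m ih =>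
      intro j hj
      have h1 := step j (by omega)
      have h2 := ih (j + 1) (by omega)
      rw [pow_succ]; linarith
  have hpow : ((1 : ℝ) / 2) ^ k ≤ 2 * (2 : ℝ) ^ (-(q / 2)) := by
    have e : ((1 : ℝ) / 2) ^ k = (2 : ℝ) ^ (-(k : ℝ)) := by
      rw [Real.rpow_neg (by norm_num), Real.rpow_natCast, one_div, inv_pow]
    have e2 : 2 * (2 : ℝ) ^ (-(q / 2)) = (2 : ℝ) ^ (1 + -(q / 2)) := by
      rw [Real.rpow_add (by norm_num), Real.rpow_one]
    rw [e, e2]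
    exact Real.rpow_le_rpow_of_exponent_le (by norm_num) (by linarith)
  rcases Nat.eq_zero_or_pos k with h0 | h0
  · have : μ.real {c | (isolated N c).card ≤ 1} ≤ 1 := measureReal_le_one
    rw [h0, pow_zero] at hpow
    linarith
  · have hsub : {c : I → ℕ | (isolated N c).card ≤ 1} ⊆
        {c | (isolated N c).card = 0} ∪ {c | (isolated N c).card = 1} := by
      intro c hc
      simp only [Set.mem_ofPred_eq, Set.mem_union] at hc ⊢
      omega
    have h1 := (measureReal_mono hsub (μ := μ)).trans (measureReal_union_le _ _)
    have h2 := main k 0 (by omega)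
    have h3 := main (k - 1) 1 (by omega)
    have h4 : ((1 : ℝ) / 2) ^ (k - 1) = 2 * (1 / 2) ^ k := by
      obtain ⟨m, hm⟩ : ∃ m, k = m + 1 := ⟨k - 1, by omega⟩
      rw [hm, Nat.add_sub_cancel, pow_succ]; ring
    rw [h4] at h3
    linarith

/-- A configuration rarely has fewer than two isolated points when the mean free mass is large
compared with the square of the mass of a neighbourhood. -/
theorem isolated_card_le_one_variance (hrefl : ∀ γ, γ ∈ N γ)
    (hsymm : ∀ γ η, η ∈ N γ → γ ∈ N η) {K : ℝ} (hK1 : 1 ≤ K)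
    (hK : ∀ γ, ∑ η ∈ N γ, (p η : ℝ) ≤ K) (hμ0 : 0 < meanFreeMass p N) :
    (countLaw p).real {c | (isolated N c).card ≤ 1} ≤ 40 * K ^ 2 / meanFreeMass p N := by
  set μ := meanFreeMass p N with hμ
  have h1 := isolated_card_le_one (p := p) hrefl hsymm (half_pos hμ0)
  rw [countLaw_occupied p fun S => freeMass p N S < μ / 2] at h1
  have h2 := freeMass_lower_tail_variance hsymm (by linarith) hK hμ0
  have h3 : (2 : ℝ) ^ (-(μ / 2 / 2)) ≤ 4 / μ := by
    rw [Real.rpow_neg (by norm_num), inv_le_comm₀ (by positivity) (by positivity), inv_div]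
    have e : μ / 2 / 2 = μ / 4 := by ring
    rw [e]
    have e2 : (2 : ℝ) ^ (μ / 4) = (2 ^ (μ / 8) : ℝ) ^ (2 : ℕ) := by
      rw [← Real.rpow_natCast, ← Real.rpow_mul (by norm_num)]; congr 1; push_cast; ring
    rw [e2]
    have e3 : (2 : ℝ) ^ (μ / 8) = Real.exp (μ / 8 * Real.log 2) := by
      rw [Real.rpow_def_of_pos (by norm_num), mul_comm]
    have h5 := Real.add_one_le_exp (μ / 8 * Real.log 2)
    have h6 := Real.log_two_gt_d9
    have h7 : 1 + 0.69 * (μ / 8) ≤ Real.exp (μ / 8 * Real.log 2) := by nlinarith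
    have h8 := pow_le_pow_left₀ (by positivity) h7 2
    rw [e3]
    nlinarith [sq_nonneg (μ / 8 - 1)]
  have h4 : 16 * K ^ 2 / μ + 24 / μ ≤ 40 * K ^ 2 / μ := by
    rw [← add_div]
    gcongr
    nlinarith
  calc _ ≤ _ := h1
    _ ≤ 4 * (4 * K ^ 2 / μ) + 6 * (4 / μ) := by gcongr
    _ = 16 * K ^ 2 / μ + 24 / μ := by ring
    _ ≤ _ := h4

/-- The exponential version of `isolated_card_le_one_variance`, in terms of the total mass `n`. -/
theorem isolated_card_le_one_exp (hrefl : ∀ γ, γ ∈ N γ)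
    (hsymm : ∀ γ η, η ∈ N γ → γ ∈ N η) {K n : ℝ} (hK1 : 1 ≤ K)
    (hK : ∀ γ, ∑ η ∈ N γ, (p η : ℝ) ≤ K) (hμ0 : 0 < meanFreeMass p N)
    (hn : ∑ γ, (p γ : ℝ) = n) :
    (countLaw p).real {c | (isolated N c).card ≤ 1} ≤
      10 * Real.exp (-(meanFreeMass p N ^ 2 / (16 * n * K ^ 2))) := by
  set μ := meanFreeMass p N with hμ
  have hμn : μ ≤ n := hn ▸ meanFreeMass_le p N
  have hn0 : 0 < n := hμ0.trans_le hμn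
  have h1 := isolated_card_le_one (p := p) hrefl hsymm (half_pos hμ0)
  rw [countLaw_occupied p fun S => freeMass p N S < μ / 2] at h1
  have h2 := freeMass_lower_tail_exp hsymm hK1 hK hn hn0
  have h3 : (2 : ℝ) ^ (-(μ / 2 / 2)) ≤ Real.exp (-(μ ^ 2 / (16 * n * K ^ 2))) := by
    rw [Real.rpow_def_of_pos (by norm_num)]
    refine Real.exp_le_exp.2 ?_
    have h6 := Real.log_two_gt_d9
    have h7 : μ ^ 2 / (16 * n * K ^ 2) ≤ μ / 16 := by
      rw [div_le_div_iff₀ (by positivity) (by norm_num)]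
      have : μ * (1 : ℝ) ≤ n * K ^ 2 := mul_le_mul hμn (by nlinarith) (by norm_num) hn0.le
      nlinarith
    nlinarith
  linarith

end Counts

/-! ### Weights of paths and meetings of two paths -/

section Paths

variable {V : Type*} {t : ℕ}

/-- The product of the transition probabilities along the path `γ`. -/
def pathWeight (P : Matrix V V ℝ) (γ : Fin (t + 1) → V) : ℝ :=
  ∏ i : Fin t, P (γ i.castSucc) (γ i.succ)

theorem pathWeight_cons (P : Matrix V V ℝ) (x : V) (γ : Fin (t + 1) → V) :
    pathWeight P (Fin.cons x γ : Fin (t + 2) → V) = P x (γ 0) * pathWeight P γ := by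
  unfold pathWeight
  rw [Fin.prod_univ_succ]
  simp

theorem pathWeight_nonneg {P : Matrix V V ℝ} (h0 : ∀ x y, 0 ≤ P x y) (γ : Fin (t + 1) → V) :
    0 ≤ pathWeight P γ :=
  Finset.prod_nonneg fun _ _ => h0 _ _

variable [Fintype V]

theorem sum_path_cons (F : (Fin (t + 2) → V) → ℝ) :
    ∑ γ, F γ = ∑ x, ∑ γ : Fin (t + 1) → V, F (Fin.cons x γ) := by
  rw [← (Fin.consEquiv fun _ => V).sum_comp, Fintype.sum_prod_type]
  rfl

theorem sum_path_zero (F : (Fin 1 → V) → ℝ) : ∑ γ, F γ = ∑ x, F fun _ => x :=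
  ((Equiv.funUnique (Fin 1) V).symm.sum_comp F).symm

/-- The path weights are invariant under the counting measure, which is stationary for a symmetric
stochastic matrix: each position of the path is uniform. -/
theorem sum_pathWeight_mul_eval {P : Matrix V V ℝ} (h1 : ∀ x, ∑ y, P x y = 1)
    (hs : ∀ x y, P x y = P y x) (t : ℕ) (s : Fin (t + 1)) (f : V → ℝ) :
    ∑ γ : Fin (t + 1) → V, pathWeight P γ * f (γ s) = ∑ u, f u := by
  induction t generalizing f with
  | zero => rw [sum_path_zero]; simp [pathWeight]
  | succ t ih =>
    rw [sum_path_cons]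
    simp_rw [pathWeight_cons]
    refine Fin.cases ?_ (fun s => ?_) s
    · simp only [Fin.cons_zero]
      refine Finset.sum_congr rfl fun x _ => ?_
      have := ih 0 (fun y => P x y)
      rw [h1] at this
      calc _ = (∑ γ : Fin (t + 1) → V, pathWeight P γ * P x (γ 0)) * f x := by
            rw [Finset.sum_mul]; exact Finset.sum_congr rfl fun γ _ => by ring
        _ = _ := by rw [this, one_mul]
    · simp only [Fin.cons_succ]
      rw [Finset.sum_comm, ← ih s f]
      refine Finset.sum_congr rfl fun γ _ => ?_
      rw [← Finset.sum_mul, ← Finset.sum_mul]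
      simp_rw [hs _ (γ 0)]
      rw [h1, one_mul]

theorem sum_pathWeight {P : Matrix V V ℝ} (h1 : ∀ x, ∑ y, P x y = 1)
    (hs : ∀ x y, P x y = P y x) (t : ℕ) :
    ∑ γ : Fin (t + 1) → V, pathWeight P γ = Fintype.card V := by
  simpa using sum_pathWeight_mul_eval h1 hs t 0 (fun _ => 1)

variable [DecidableEq V]

/-- The paths that are at the same vertex as `γ` at some common time. -/
def meetNbhd (γ : Fin (t + 1) → V) : Finset (Fin (t + 1) → V) :=
  Finset.univ.filter fun η => ∃ s, γ s = η s

theorem mem_meetNbhd {γ η : Fin (t + 1) → V} : η ∈ meetNbhd γ ↔ ∃ s, γ s = η s := by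
  simp [meetNbhd]

theorem self_mem_meetNbhd (γ : Fin (t + 1) → V) : γ ∈ meetNbhd γ := mem_meetNbhd.2 ⟨0, rfl⟩

theorem mem_meetNbhd_symm (γ η : Fin (t + 1) → V) (h : η ∈ meetNbhd γ) : γ ∈ meetNbhd η := by
  obtain ⟨s, hs⟩ := mem_meetNbhd.1 h
  exact mem_meetNbhd.2 ⟨s, hs.symm⟩

theorem sum_meetNbhd_le {P : Matrix V V ℝ} (h0 : ∀ x y, 0 ≤ P x y) (h1 : ∀ x, ∑ y, P x y = 1)
    (hs : ∀ x y, P x y = P y x) (γ : Fin (t + 1) → V) :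
    ∑ η ∈ meetNbhd γ, pathWeight P η ≤ t + 1 := by
  calc ∑ η ∈ meetNbhd γ, pathWeight P η
      ≤ ∑ η : Fin (t + 1) → V, ∑ s, pathWeight P η * (if η s = γ s then 1 else 0) := by
        rw [meetNbhd, Finset.sum_filter]
        refine Finset.sum_le_sum fun η _ => ?_
        have hw := pathWeight_nonneg h0 η
        split_ifs with h
        · obtain ⟨s, hs⟩ := h
          refine le_trans (le_of_eq ?_) (Finset.single_le_sum (fun s _ => ?_) (Finset.mem_univ s))
          · simp [hs]
          · positivity
        · exact Finset.sum_nonneg fun s _ => by positivity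
    _ = ∑ s : Fin (t + 1), (1 : ℝ) := by
        rw [Finset.sum_comm]
        refine Finset.sum_congr rfl fun s _ => ?_
        rw [sum_pathWeight_mul_eval h1 hs t s (fun u => if u = γ s then 1 else 0)]
        simp
    _ = t + 1 := by simp

/-- The weight of the pairs of paths from `x` and `y` that meet. -/
def meetMass (P : Matrix V V ℝ) (t : ℕ) (x y : V) : ℝ :=
  ∑ γ : Fin (t + 1) → V, (if γ 0 = x then pathWeight P γ else 0) *
    ∑ η : Fin (t + 1) → V, (if η 0 = y then pathWeight P η else 0) *
      (if ∃ s, γ s = η s then 1 else 0)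

theorem sum_path_from_cons (P : Matrix V V ℝ) (x : V) (F : (Fin (t + 2) → V) → ℝ) :
    ∑ γ : Fin (t + 2) → V, (if γ 0 = x then pathWeight P γ else 0) * F γ =
      ∑ z, P x z * ∑ γ : Fin (t + 1) → V, (if γ 0 = z then pathWeight P γ else 0) *
        F (Fin.cons x γ) := by
  rw [sum_path_cons]
  simp only [Fin.cons_zero, pathWeight_cons, ite_mul, zero_mul]
  rw [Finset.sum_comm]
  simp only [Finset.mul_sum, mul_ite, mul_zero]
  rw [Finset.sum_comm (s := (Finset.univ : Finset V))]
  refine Finset.sum_congr rfl fun γ _ => ?_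
  simp only [Finset.sum_ite_eq, Finset.sum_ite_eq', Finset.mem_univ, if_true]
  ring

theorem sum_path_from {P : Matrix V V ℝ} (h1 : ∀ x, ∑ y, P x y = 1) (t : ℕ) (x : V) :
    ∑ γ : Fin (t + 1) → V, (if γ 0 = x then pathWeight P γ else 0) = 1 := by
  induction t generalizing x with
  | zero => rw [sum_path_zero]; simp [pathWeight]
  | succ t ih =>
    have := sum_path_from_cons (t := t) P x (fun _ => 1)
    simp only [mul_one] at this
    rw [this]
    simp_rw [ih, mul_one, h1]

theorem meetMass_le_one {P : Matrix V V ℝ} (h0 : ∀ x y, 0 ≤ P x y) (h1 : ∀ x, ∑ y, P x y = 1)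
    (t : ℕ) (x y : V) : meetMass P t x y ≤ 1 := by
  have hw : ∀ (z : V) (γ : Fin (t + 1) → V), 0 ≤ if γ 0 = z then pathWeight P γ else 0 := by
    intro z γ; split_ifs
    · exact pathWeight_nonneg h0 γ
    · rfl
  calc meetMass P t x y
      ≤ ∑ γ : Fin (t + 1) → V, (if γ 0 = x then pathWeight P γ else 0) *
        ∑ η : Fin (t + 1) → V, (if η 0 = y then pathWeight P η else 0) * 1 := by
        refine Finset.sum_le_sum fun γ _ => mul_le_mul_of_nonneg_left ?_ (hw _ _)
        refine Finset.sum_le_sum fun η _ => mul_le_mul_of_nonneg_left ?_ (hw _ _)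
        split_ifs <;> norm_num
    _ = 1 := by simp_rw [mul_one, sum_path_from h1, mul_one, sum_path_from h1]

theorem meetMass_succ (P : Matrix V V ℝ) (t : ℕ) {x y : V} (hxy : x ≠ y) :
    meetMass P (t + 1) x y = ∑ z, P x z * ∑ w, P y w * meetMass P t z w := by
  unfold meetMass
  rw [sum_path_from_cons]
  refine Finset.sum_congr rfl fun z _ => ?_
  congr 1
  simp_rw [sum_path_from_cons P y]
  have : ∀ γ η : Fin (t + 1) → V, (∃ s, (Fin.cons x γ : Fin (t + 2) → V) s =
      (Fin.cons y η : Fin (t + 2) → V) s) ↔ ∃ s, γ s = η s := by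
    intro γ η
    rw [Fin.exists_fin_succ]
    simp [hxy]
  simp_rw [this, Finset.mul_sum]
  rw [Finset.sum_comm]
  refine Finset.sum_congr rfl fun w _ => Finset.sum_congr rfl fun γ _ =>
    Finset.sum_congr rfl fun η _ => by ring

theorem pow_apply_nonneg {P : Matrix V V ℝ} (h0 : ∀ x y, 0 ≤ P x y) (m : ℕ) (x y : V) :
    0 ≤ (P ^ m) x y := by
  induction m generalizing x y with
  | zero => rw [pow_zero, Matrix.one_apply]; split_ifs <;> norm_num
  | succ m ih =>
    rw [pow_succ, Matrix.mul_apply]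
    exact Finset.sum_nonneg fun z _ => mul_nonneg (ih x z) (h0 z y)

theorem pow_row_sum {P : Matrix V V ℝ} (h1 : ∀ x, ∑ y, P x y = 1) (m : ℕ) (x : V) :
    ∑ y, (P ^ m) x y = 1 := by
  induction m generalizing x with
  | zero => simp [Matrix.one_apply]
  | succ m ih =>
    simp_rw [pow_succ, Matrix.mul_apply]
    rw [Finset.sum_comm]
    simp_rw [← Finset.mul_sum, h1, mul_one, ih]

theorem pow_apply_symm {P : Matrix V V ℝ} (hs : ∀ x y, P x y = P y x) (m : ℕ) (x y : V) :
    (P ^ m) x y = (P ^ m) y x := by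
  have h : P.IsSymm := by ext i j; exact hs j i
  exact ((h.pow m).apply y x)

theorem sum_pow_two_mul_succ {P : Matrix V V ℝ} (hs : ∀ x y, P x y = P y x) (s : ℕ) (x y : V) :
    (P ^ (2 * (s + 1))) x y = ∑ z, P x z * ∑ w, P y w * (P ^ (2 * s)) z w := by
  have : P ^ (2 * (s + 1)) = P * (P ^ (2 * s) * P) := by
    rw [← pow_succ, ← pow_succ']; congr 1
  rw [this, Matrix.mul_apply]
  refine Finset.sum_congr rfl fun z _ => ?_
  rw [Matrix.mul_apply]
  congr 1
  exact Finset.sum_congr rfl fun w _ => by rw [hs w y, mul_comm]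

/-- After the first meeting, the expected number of further meetings within `r` steps is at least
`k`; hence the meeting probability times `k` is at most the expected number of meetings. -/
theorem meetMass_mul_le {P : Matrix V V ℝ} (h0 : ∀ x y, 0 ≤ P x y) (h1 : ∀ x, ∑ y, P x y = 1)
    (hs : ∀ x y, P x y = P y x) {k : ℝ} (hk0 : 0 ≤ k) {r : ℕ}
    (hk : ∀ u, k ≤ ∑ s ∈ Finset.range (r + 1), (P ^ (2 * s)) u u) (t : ℕ) (x y : V) :
    meetMass P t x y * k ≤ ∑ s ∈ Finset.range (t + r + 1), (P ^ (2 * s)) x y := by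
  have diag : ∀ t z, meetMass P t z z * k ≤
      ∑ s ∈ Finset.range (t + r + 1), (P ^ (2 * s)) z z := by
    intro t z
    calc meetMass P t z z * k ≤ 1 * k :=
          mul_le_mul_of_nonneg_right (meetMass_le_one h0 h1 t z z) hk0
      _ = k := one_mul k
      _ ≤ _ := hk z
      _ ≤ _ := Finset.sum_le_sum_of_subset_of_nonneg
          (Finset.range_subset_range.2 (by omega)) fun s _ _ => pow_apply_nonneg h0 _ _ _
  induction t generalizing x y with
  | zero =>
    by_cases hxy : x = y
    · exact hxy ▸ diag 0 x
    · have : meetMass P 0 x y = 0 := by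
        unfold meetMass
        refine Finset.sum_eq_zero fun γ _ => ?_
        rw [Finset.mul_sum]
        refine Finset.sum_eq_zero fun η _ => ?_
        have : (∃ s, γ s = η s) ↔ γ 0 = η 0 :=
          ⟨fun ⟨s, hs⟩ => by rwa [show s = 0 from Fin.ext (by omega)] at hs, fun h => ⟨0, h⟩⟩
        by_cases h : γ 0 = x <;> by_cases h' : η 0 = y <;> simp [this, h, h', hxy]
      rw [this, zero_mul]
      exact Finset.sum_nonneg fun s _ => pow_apply_nonneg h0 _ _ _
  | succ t ih =>
    by_cases hxy : x = y
    · exact hxy ▸ diag (t + 1) x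
    · calc meetMass P (t + 1) x y * k
          = ∑ z, P x z * ∑ w, P y w * (meetMass P t z w * k) := by
            rw [meetMass_succ P t hxy, Finset.sum_mul]
            simp_rw [Finset.mul_sum, Finset.sum_mul]
            exact Finset.sum_congr rfl fun z _ => Finset.sum_congr rfl fun w _ => by ring
        _ ≤ ∑ z, P x z * ∑ w, P y w * ∑ s ∈ Finset.range (t + r + 1), (P ^ (2 * s)) z w := by
            refine Finset.sum_le_sum fun z _ => mul_le_mul_of_nonneg_left ?_ (h0 _ _)
            exact Finset.sum_le_sum fun w _ => mul_le_mul_of_nonneg_left (ih z w) (h0 _ _)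
        _ = ∑ s ∈ Finset.range (t + r + 1), (P ^ (2 * (s + 1))) x y := by
            simp_rw [sum_pow_two_mul_succ hs, Finset.mul_sum]
            rw [Finset.sum_comm' (t' := Finset.univ) (s' := fun _ => Finset.univ) (by simp)]
            rw [Finset.sum_comm]
            rw [Finset.sum_comm (s := Finset.range _)]
            refine Finset.sum_congr rfl fun z _ => ?_
            rw [Finset.sum_comm]
        _ ≤ _ := by
            rw [show t + 1 + r + 1 = (t + r + 1) + 1 by ring,
              Finset.sum_range_succ' _ (t + r + 1)]
            linarith [pow_apply_nonneg h0 (2 * 0) x y]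

/-- The weight of the pairs of meeting paths. -/
theorem sum_pathWeight_meetNbhd_le {P : Matrix V V ℝ} (h0 : ∀ x y, 0 ≤ P x y)
    (h1 : ∀ x, ∑ y, P x y = 1) (hs : ∀ x y, P x y = P y x) {k : ℝ} (hk0 : 0 ≤ k) {r : ℕ}
    (hk : ∀ u, k ≤ ∑ s ∈ Finset.range (r + 1), (P ^ (2 * s)) u u) (t : ℕ) :
    (∑ γ : Fin (t + 1) → V, pathWeight P γ * ∑ η ∈ meetNbhd γ, pathWeight P η) * k ≤
      Fintype.card V * (t + r + 1) := by
  have e : ∑ γ : Fin (t + 1) → V, pathWeight P γ * ∑ η ∈ meetNbhd γ, pathWeight P η =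
      ∑ x, ∑ y, meetMass P t x y := by
    have fib : ∀ (F : (Fin (t + 1) → V) → ℝ), ∑ x, ∑ γ : Fin (t + 1) → V,
        (if γ 0 = x then pathWeight P γ else 0) * F γ = ∑ γ, pathWeight P γ * F γ := by
      intro F
      rw [Finset.sum_comm]
      refine Finset.sum_congr rfl fun γ _ => ?_
      rw [← Finset.sum_mul]; simp
    have e1 : ∀ x, ∑ y, meetMass P t x y = ∑ γ : Fin (t + 1) → V,
        (if γ 0 = x then pathWeight P γ else 0) * ∑ η : Fin (t + 1) → V, pathWeight P η *
          (if ∃ s, γ s = η s then 1 else 0) := by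
      intro x
      unfold meetMass
      rw [Finset.sum_comm]
      refine Finset.sum_congr rfl fun γ _ => ?_
      rw [← Finset.mul_sum, fib]
    simp_rw [e1]
    rw [fib]
    refine Finset.sum_congr rfl fun γ _ => ?_
    rw [meetNbhd, Finset.sum_filter]
    simp
  rw [e, Finset.sum_mul]
  calc ∑ x, (∑ y, meetMass P t x y) * k
      ≤ ∑ x, ∑ y, ∑ s ∈ Finset.range (t + r + 1), (P ^ (2 * s)) x y := by
        refine Finset.sum_le_sum fun x _ => ?_
        rw [Finset.sum_mul]
        exact Finset.sum_le_sum fun y _ => meetMass_mul_le h0 h1 hs hk0 hk t x y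
    _ = ∑ x : V, (t + r + 1 : ℝ) := by
        refine Finset.sum_congr rfl fun x _ => ?_
        rw [Finset.sum_comm]
        simp_rw [pow_row_sum h1]
        simp
    _ = _ := by rw [Finset.sum_const, nsmul_eq_mul, Finset.card_univ]

end Paths

/-! ### The law of the first steps of a walk -/

section PathLaw

/-- The first `t + 1` positions of a trajectory. -/
def pathPrefix {V : Type*} (t : ℕ) (x : ℕ → V) : Fin (t + 1) → V := fun i => x i

theorem measurable_pathPrefix {V : Type*} [MeasurableSpace V] (t : ℕ) : Measurable (pathPrefix (V := V) t) :=
  measurable_pi_lambda _ fun _ => measurable_pi_apply _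

variable {V : Type*} [Fintype V] [DecidableEq V] [MeasurableSpace V] [DiscreteMeasurableSpace V]

theorem stepKernel_singleton (G : SimpleGraph V) [DecidableRel G.Adj] (x y : V) :
    stepKernel G x {y} = ENNReal.ofReal (lazyWalk G x y) := by
  change (stepPMF G x).toMeasure {y} = _
  rw [PMF.toMeasure_apply_singleton _ _ (measurableSet_singleton y)]
  rfl

/-- The probability that the walk from `v` follows `g` up to time `t`. -/
theorem partialTraj_singleton (G : SimpleGraph V) [DecidableRel G.Adj] (v : V) (g : ℕ → V)
    (t : ℕ) :
    Kernel.partialTraj (X := fun _ => V) (historyKernel G) 0 t (fun _ => v)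
        {fun i : Finset.Iic t => g i} =
      (if g 0 = v then 1 else 0) *
        ∏ i ∈ Finset.range t, ENNReal.ofReal (lazyWalk G (g i) (g (i + 1))) := by
  induction t with
  | zero =>
    rw [Kernel.partialTraj_self, Kernel.id_apply,
      Measure.dirac_apply' _ (measurableSet_singleton _)]
    simp only [Finset.range_zero, Finset.prod_empty, mul_one, Set.indicator_apply,
      Set.mem_singleton_iff, Pi.one_apply]
    refine if_congr ?_ rfl rfl
    constructor
    · intro h; exact (congrFun h ⟨0, by simp⟩).symm
    · intro h; ext ⟨i, hi⟩
      have : i = 0 := by simpa using hi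
      subst this; exact h.symm
  | succ t ih =>
    have hpre : IicProdIoc (X := fun _ => V) t (t + 1) ⁻¹' {fun i : Finset.Iic (t + 1) => g i} =
        {fun i : Finset.Iic t => g i} ×ˢ
          (MeasurableEquiv.piSingleton (X := fun _ => V) t '' {g (t + 1)}) := by
      ext ⟨a, b⟩
      simp only [Set.mem_preimage, Set.mem_singleton_iff, Set.image_singleton, Set.mem_prod]
      constructor
      · intro h
        constructor
        · ext ⟨i, hi⟩
          have hi' : i ≤ t := Finset.mem_Iic.1 hi
          have := congrFun h ⟨i, Finset.mem_Iic.2 (by omega)⟩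
          simpa [IicProdIoc, hi'] using this
        · rw [← MeasurableEquiv.symm_apply_eq]
          have := congrFun h ⟨t + 1, Finset.mem_Iic.2 le_rfl⟩
          change b ⟨t + 1, _⟩ = g (t + 1)
          simpa [IicProdIoc] using this
      · rintro ⟨rfl, rfl⟩
        ext ⟨i, hi⟩
        have hi' : i ≤ t + 1 := Finset.mem_Iic.1 hi
        by_cases h : i ≤ t
        · simp [IicProdIoc, h]
        · have : i = t + 1 := by omega
          subst this
          simp only [IicProdIoc, add_le_iff_nonpos_right, nonpos_iff_eq_zero, one_ne_zero,
            dite_false]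
          rfl
    rw [Kernel.partialTraj_succ_of_le (Nat.zero_le t),
      Kernel.map_apply' _ (by fun_prop) _ (measurableSet_singleton _), hpre,
      Kernel.comp_apply' _ _ _ (by
        rw [← hpre]; exact (by fun_prop : Measurable _) (measurableSet_singleton _))]
    have hk : ∀ h : (i : Finset.Iic t) → V,
        (Kernel.id ×ₖ ((historyKernel G t).map (MeasurableEquiv.piSingleton (X := fun _ => V) t))) h
          ({fun i : Finset.Iic t => g i} ×ˢ
            (MeasurableEquiv.piSingleton (X := fun _ => V) t '' {g (t + 1)})) =
        ({fun i : Finset.Iic t => g i} : Set ((i : Finset.Iic t) → V)).indicator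
          (fun _ => ENNReal.ofReal (lazyWalk G (g t) (g (t + 1)))) h := by
      intro h
      have hm := (MeasurableEquiv.piSingleton (X := fun _ => V) t).measurableSet_image.2
        (measurableSet_singleton (g (t + 1)))
      have : IsMarkovKernel ((historyKernel G t).map
          (MeasurableEquiv.piSingleton (X := fun _ => V) t)) :=
        Kernel.IsMarkovKernel.map _ (MeasurableEquiv.measurable _)
      rw [Kernel.prod_apply, Measure.prod_prod, Kernel.id_apply,
        Measure.dirac_apply' _ (measurableSet_singleton _),
        Kernel.map_apply' _ (MeasurableEquiv.measurable _) _ hm,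
        Set.preimage_image_eq _ (MeasurableEquiv.injective _)]
      by_cases e : h = fun i : Finset.Iic t => g i
      · subst e
        simp only [Set.indicator_apply, Set.mem_singleton_iff, if_true, Pi.one_apply, one_mul]
        rw [historyKernel, Kernel.comap_apply, stepKernel_singleton]
      · simp [e]
    simp_rw [hk]
    rw [lintegral_indicator_const (measurableSet_singleton _), ih, Finset.prod_range_succ]
    ring

theorem walkLaw_pathPrefix (G : SimpleGraph V) [DecidableRel G.Adj] (v : V) {t : ℕ}
    (γ : Fin (t + 1) → V) :
    (walkLaw G v).real (pathPrefix t ⁻¹' {γ}) =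
      if γ 0 = v then pathWeight (lazyWalk G) γ else 0 := by
  set g : ℕ → V := fun i => if h : i < t + 1 then γ ⟨i, h⟩ else v with hg
  have hgi : ∀ (i : ℕ) (h : i < t + 1), g i = γ ⟨i, h⟩ := fun i h => dif_pos h
  have e1 : pathPrefix t ⁻¹' {γ} =
      Preorder.frestrictLe (π := fun _ => V) t ⁻¹' {fun i : Finset.Iic t => g i} := by
    ext x
    simp only [Set.mem_preimage, Set.mem_singleton_iff, funext_iff, pathPrefix]
    constructor
    · rintro h ⟨i, hi⟩
      have hi' : i < t + 1 := Nat.lt_succ_of_le (Finset.mem_Iic.1 hi)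
      exact (h ⟨i, hi'⟩).trans (hgi i hi').symm
    · intro h i
      exact (h ⟨i, Finset.mem_Iic.2 (by omega)⟩).trans (hgi i i.2)
  have e2 : walkLaw G v (pathPrefix t ⁻¹' {γ}) =
      (if g 0 = v then 1 else 0) *
        ∏ i ∈ Finset.range t, ENNReal.ofReal (lazyWalk G (g i) (g (i + 1))) := by
    rw [e1, ← Measure.map_apply (by fun_prop) (measurableSet_singleton _), walkLaw,
      Kernel.traj_map_frestrictLe_apply, partialTraj_singleton]
  have g0 : g 0 = γ 0 := hgi 0 (by omega)
  rw [measureReal_def, e2, g0, Finset.prod_range, ENNReal.toReal_mul, ENNReal.toReal_prod]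
  have : ∏ i : Fin t, (ENNReal.ofReal (lazyWalk G (g i) (g (i + 1)))).toReal =
      pathWeight (lazyWalk G) γ := by
    refine Finset.prod_congr rfl fun i _ => ?_
    rw [ENNReal.toReal_ofReal (lazyWalk_nonneg G _ _)]
    have h1 : (i : ℕ) < t + 1 := by omega
    have h2 : (i : ℕ) + 1 < t + 1 := by omega
    rw [hgi i h1, hgi (i + 1) h2]
    rfl
  rw [this]
  split_ifs <;> simp

end PathLaw

/-! ### The numbers of walkers following each path are independent Poisson variables -/

section Thinning

open Complex (I)

/-- The number of walkers that follow the path `γ` up to time `t`. -/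
def pathCount {V : Type*} [Fintype V] [DecidableEq V] (t : ℕ) (ω : Config V)
    (γ : Fin (t + 1) → V) : ℕ :=
  ∑ v, ((Finset.range (ω.1 v)).filter fun k => pathPrefix t (ω.2 (v, k)) = γ).card

/-- The mean number of walkers that follow the path `γ`. -/
def pathRate {V : Type*} [Fintype V] [DecidableEq V] (G : SimpleGraph V) [DecidableRel G.Adj]
    (t : ℕ) (γ : Fin (t + 1) → V) : ℝ≥0 :=
  meanWalkers G (γ 0) * ⟨pathWeight (lazyWalk G) γ, pathWeight_nonneg (lazyWalk_nonneg G) γ⟩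

theorem pathRate_coe {V : Type*} [Fintype V] [DecidableEq V] (G : SimpleGraph V)
    [DecidableRel G.Adj] (t : ℕ) (γ : Fin (t + 1) → V) :
    (pathRate G t γ : ℝ) = meanWalkers G (γ 0) * pathWeight (lazyWalk G) γ := rfl

theorem integral_pow_poissonMeasure (r : ℝ≥0) (z : ℂ) :
    ∫ k, z ^ k ∂poissonMeasure r = Complex.exp (r * (z - 1)) := by
  rw [integral_poissonMeasure]
  have h : ∀ k : ℕ, (Real.exp (-r) * r ^ k / (k.factorial : ℝ)) • z ^ k =
      (Real.exp (-r) : ℂ) * ((r * z) ^ k / k.factorial) := by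
    intro k
    rw [Complex.real_smul]; push_cast; rw [mul_pow]; ring
  simp_rw [h]
  rw [tsum_mul_left, (NormedSpace.expSeries_div_hasSum_exp ((r : ℂ) * z)).tsum_eq,
    ← Complex.exp_eq_exp_ℂ, Complex.ofReal_exp, ← Complex.exp_add]
  congr 1; push_cast; ring

variable {V : Type*} [Fintype V] [DecidableEq V] [MeasurableSpace V] [DiscreteMeasurableSpace V]

theorem measurable_pathCount (t : ℕ) : Measurable (pathCount (V := V) t) := by
  refine measurable_from_prod_countable_right fun N => ?_
  refine measurable_pi_lambda _ fun γ => ?_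
  simp only [pathCount, Finset.card_filter]
  refine Finset.measurable_sum _ fun v _ => Finset.measurable_sum _ fun k _ => ?_
  refine Measurable.ite ?_ measurable_const measurable_const
  exact ((measurable_pathPrefix t).comp (measurable_pi_apply (v, k))) (measurableSet_singleton γ)

theorem integral_walkLaw_pathPrefix (G : SimpleGraph V) [DecidableRel G.Adj] (v : V) {t : ℕ}
    (ψ : (Fin (t + 1) → V) → ℂ) :
    ∫ x, ψ (pathPrefix t x) ∂walkLaw G v - 1 =
      ∑ γ : Fin (t + 1) → V, ((if γ 0 = v then pathWeight (lazyWalk G) γ else 0 : ℝ) : ℂ) *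
        (ψ γ - 1) := by
  have hm := measurable_pathPrefix (V := V) t
  have : IsProbabilityMeasure ((walkLaw G v).map (pathPrefix t)) :=
    Measure.isProbabilityMeasure_map hm.aemeasurable
  rw [← integral_map (f := ψ) hm.aemeasurable
    (Measurable.of_discrete : Measurable ψ).aestronglyMeasurable,
    integral_fintype .of_finite]
  simp_rw [map_measureReal_apply hm (measurableSet_singleton _), walkLaw_pathPrefix,
    mul_sub, mul_one, Finset.sum_sub_distrib, Complex.real_smul]
  congr 1
  rw [← Complex.ofReal_sum, sum_path_from (lazyWalk_sum G), Complex.ofReal_one]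

theorem integral_prod_infinitePi {ι : Type*} {X : ι → Type*} [∀ i, MeasurableSpace (X i)]
    (μ : (i : ι) → Measure (X i)) [∀ i, IsProbabilityMeasure (μ i)] (s : Finset ι)
    (f : (i : ι) → X i → ℂ) (hf : ∀ i, Measurable (f i)) :
    ∫ x, ∏ i ∈ s, f i (x i) ∂Measure.infinitePi μ = ∏ i ∈ s, ∫ y, f i y ∂μ i := by
  have hm : Measurable fun y : (i : s) → X i => ∏ i : s, f i (y i) :=
    Finset.measurable_prod _ fun i _ => (hf i).comp (measurable_pi_apply i)
  have h := integral_restrict_infinitePi (μ := μ) (s := s)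
    (f := fun y : (i : s) → X i => ∏ i : s, f i (y i)) hm.aestronglyMeasurable
  rw [integral_fintype_prod_eq_prod (fun i : s => f i),
    Finset.prod_coe_sort s (fun i => ∫ y, f i y ∂μ i)] at h
  rw [← h]
  refine integral_congr_ae (Filter.Eventually.of_forall fun x => ?_)
  exact (Finset.prod_coe_sort s fun i => f i (x i)).symm

/-- The Laplace functional (on the imaginary axis) of the walkers' paths. -/
theorem integral_exp_pathCount (G : SimpleGraph V) [DecidableRel G.Adj] (t : ℕ)
    (θ : (Fin (t + 1) → V) → ℝ) :
    ∫ ω, Complex.exp ((∑ γ, (pathCount t ω γ : ℝ) * θ γ : ℝ) * I) ∂snMeasure G =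
      ∏ γ, Complex.exp (pathRate G t γ * (Complex.exp (θ γ * I) - 1)) := by
  set ψ : (Fin (t + 1) → V) → ℂ := fun γ => Complex.exp (θ γ * I) with hψ
  have hψm : Measurable ψ := Measurable.of_discrete
  have e1 : ∀ ω : Config V, Complex.exp ((∑ γ, (pathCount t ω γ : ℝ) * θ γ : ℝ) * I) =
      ∏ v, ∏ k ∈ Finset.range (ω.1 v), ψ (pathPrefix t (ω.2 (v, k))) := by
    intro ω
    simp only [hψ, ← Complex.exp_sum]
    congr 1
    rw [Complex.ofReal_sum, Finset.sum_mul]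
    simp only [pathCount, Nat.cast_sum, Complex.ofReal_mul, Complex.ofReal_sum, Finset.sum_mul]
    rw [Finset.sum_comm]
    refine Finset.sum_congr rfl fun v _ => ?_
    simp only [Finset.card_filter, Nat.cast_sum, Complex.ofReal_sum, Finset.sum_mul]
    rw [Finset.sum_comm]
    refine Finset.sum_congr rfl fun k _ => ?_
    rw [Finset.sum_eq_single (pathPrefix t (ω.2 (v, k)))]
    · simp
    · intro γ _ hγ
      simp [hγ.symm]
    · simp
  have hmeas : Measurable fun ω : Config V =>
      Complex.exp ((∑ γ, (pathCount t ω γ : ℝ) * θ γ : ℝ) * I) := by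
    have := measurable_pathCount (V := V) t
    have h2 : Measurable fun c : (Fin (t + 1) → V) → ℕ =>
      Complex.exp ((∑ γ, (c γ : ℝ) * θ γ : ℝ) * I) := Measurable.of_discrete
    exact h2.comp this
  have hint : Integrable (fun ω : Config V =>
      Complex.exp ((∑ γ, (pathCount t ω γ : ℝ) * θ γ : ℝ) * I)) (snMeasure G) := by
    refine Integrable.of_bound hmeas.aestronglyMeasurable 1 (Filter.Eventually.of_forall fun ω => ?_)
    rw [Complex.norm_exp_ofReal_mul_I]
  have e2 : ∀ N : V → ℕ,
      ∫ x, ∏ v, ∏ k ∈ Finset.range (N v), ψ (pathPrefix t (x (v, k)))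
        ∂(Measure.infinitePi fun w : Label V => walkLaw G w.1) =
      ∏ v, (∫ x, ψ (pathPrefix t x) ∂walkLaw G v) ^ N v := by
    intro N
    set r : Finset (Label V) :=
      Finset.univ.biUnion fun v => (Finset.range (N v)).image (Prod.mk v) with hr
    have hmem : ∀ w : Label V, w ∈ r ↔ w.1 ∈ Finset.univ ∧ w.2 ∈ Finset.range (N w.1) := by
      rintro ⟨v, k⟩; simp [hr]
    have h := integral_prod_infinitePi (fun w : Label V => walkLaw G w.1) r
      (fun _ x => ψ (pathPrefix t x)) fun _ => hψm.comp (measurable_pathPrefix t)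
    simp_rw [Finset.prod_finset_product r Finset.univ (fun v => Finset.range (N v)) hmem,
      Finset.prod_const, Finset.card_range] at h
    exact h
  rw [snMeasure, integral_prod _ hint]
  simp_rw [e1, e2]
  rw [integral_fintype_prod_eq_prod
    (fun v k => (∫ x, ψ (pathPrefix t x) ∂walkLaw G v) ^ k)]
  simp_rw [integral_pow_poissonMeasure, integral_walkLaw_pathPrefix]
  rw [← Complex.exp_sum, ← Complex.exp_sum]
  congr 1
  simp_rw [Finset.mul_sum]
  rw [Finset.sum_comm]
  refine Finset.sum_congr rfl fun γ _ => ?_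
  rw [Finset.sum_eq_single (γ 0)]
  · simp [pathRate_coe, mul_assoc, hψ]
  · intro v _ hv
    simp [hv.symm]
  · simp

theorem map_pathCount_snMeasure (G : SimpleGraph V) [DecidableRel G.Adj] (t : ℕ) :
    (snMeasure G).map (pathCount t) = countLaw (pathRate G t) := by
  set J := Fin (t + 1) → V
  set cast : (J → ℕ) → J → ℝ := fun c γ => c γ with hcast
  have hcm : Measurable cast := Measurable.of_discrete
  have hpm := measurable_pathCount (V := V) t
  have hci : Function.Injective cast := by
    intro c d h; ext γ
    exact Nat.cast_injective (congrFun h γ)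
  have : IsProbabilityMeasure ((snMeasure G).map (cast ∘ pathCount t)) :=
    Measure.isProbabilityMeasure_map (hcm.comp hpm).aemeasurable
  have key : (snMeasure G).map (cast ∘ pathCount t) =
      Measure.pi fun γ => (poissonMeasure (pathRate G t γ)).map (Nat.cast : ℕ → ℝ) := by
    rw [← charFun_eq_pi_iff]
    intro θ
    simp_rw [charFun_map_cast_poissonMeasure]
    rw [charFun_apply, integral_map (by fun_prop) (by fun_prop),
      integral_map (hcm.comp hpm).aemeasurable (by fun_prop)]
    rw [← integral_exp_pathCount G t (fun γ => θ γ)]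
    refine integral_congr_ae (Filter.Eventually.of_forall fun ω => ?_)
    simp only [PiLp.inner_apply, Function.comp_apply, hcast]
    congr 3
    refine Finset.sum_congr rfl fun γ _ => ?_
    simp [mul_comm]
  refine Measure.ext_of_singleton fun c => ?_
  have h := congrArg (fun m : Measure (J → ℝ) => m {cast c}) key
  beta_reduce at h
  rw [Measure.pi_singleton, ← Measure.map_map hcm hpm, Measure.map_apply hcm
    (measurableSet_singleton _)] at h
  have e : cast ⁻¹' {cast c} = {c} := by
    ext d; simp [hci.eq_iff]
  rw [e] at h
  rw [h, countLaw, Measure.pi_singleton]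
  refine Finset.prod_congr rfl fun γ _ => ?_
  rw [Measure.map_apply .of_discrete (measurableSet_singleton _)]
  congr 1
  ext k; simp [hcast]

end Thinning

/-! ### Isolated walkers prevent social connectivity -/

section Connectivity

theorem AcquaintedBy.mono {V : Type*} {ω : Config V} {s t : ℕ} (hst : s ≤ t) {a b : Walker ω}
    (h : AcquaintedBy ω s a b) : AcquaintedBy ω t a b :=
  have hm : MetBy ω s ≤ MetBy ω t := fun _ _ ⟨r, hr, e⟩ => ⟨r, hr.trans hst, e⟩
  Relation.TransGen.mono hm a b h

theorem socialConnectivityTime_lt {V : Type*} {ω : Config V} {T : ℕ∞}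
    (h : socialConnectivityTime ω < T) :
    ∃ t : ℕ, (t : ℕ∞) < T ∧ ∀ a b : Walker ω, AcquaintedBy ω t a b := by
  obtain ⟨S, ⟨t, rfl, ht⟩, hS⟩ := sInf_lt_iff.1 h
  exact ⟨t, hS, ht⟩

variable {V : Type*} [Fintype V] [DecidableEq V] {t : ℕ} {ω : Config V}

theorem pathCount_eq_card (γ : Fin (t + 1) → V) :
    pathCount t ω γ = (Finset.univ.sigma fun v => (Finset.range (ω.1 v)).filter fun k =>
      pathPrefix t (ω.2 (v, k)) = γ).card := by
  rw [Finset.card_sigma, pathCount]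

theorem exists_walker_of_pathCount_ne_zero {γ : Fin (t + 1) → V} (h : pathCount t ω γ ≠ 0) :
    ∃ a : Walker ω, pathPrefix t (ω.2 a.1) = γ := by
  rw [pathCount_eq_card, Finset.card_ne_zero] at h
  obtain ⟨⟨v, k⟩, hw⟩ := h
  simp only [Finset.mem_sigma, Finset.mem_univ, true_and, Finset.mem_filter,
    Finset.mem_range] at hw
  exact ⟨⟨(v, k), hw.1⟩, hw.2⟩

theorem pathCount_pathPrefix_ne_zero (a : Walker ω) :
    pathCount t ω (pathPrefix t (ω.2 a.1)) ≠ 0 := by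
  rw [pathCount_eq_card, Finset.card_ne_zero]
  obtain ⟨⟨v, k⟩, hw⟩ := a
  exact ⟨⟨v, k⟩, by simpa using hw⟩

theorem walker_eq_of_pathCount_eq_one {γ : Fin (t + 1) → V} (h : pathCount t ω γ = 1)
    {a b : Walker ω} (ha : pathPrefix t (ω.2 a.1) = γ) (hb : pathPrefix t (ω.2 b.1) = γ) :
    a = b := by
  rw [pathCount_eq_card] at h
  obtain ⟨⟨v, k⟩, hw⟩ := a
  obtain ⟨⟨v', k'⟩, hw'⟩ := b
  have := Finset.card_le_one.1 h.le ⟨v, k⟩ (by simpa using ⟨hw, ha⟩) ⟨v', k'⟩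
    (by simpa using ⟨hw', hb⟩)
  obtain ⟨rfl, h2⟩ := Sigma.mk.inj_iff.1 this
  obtain rfl := eq_of_heq h2
  rfl

/-- Two isolated walkers have no path of acquaintances: the first only ever meets itself. -/
theorem card_isolated_le_one_of_acquainted (h : ∀ a b : Walker ω, AcquaintedBy ω t a b) :
    (isolated meetNbhd (pathCount t ω)).card ≤ 1 := by
  rw [Finset.card_le_one]
  intro γ hγ γ' hγ'
  simp only [isolated, Finset.mem_filter, Finset.mem_univ, true_and] at hγ hγ'
  obtain ⟨a, ha⟩ := exists_walker_of_pathCount_ne_zero (ω := ω) (γ := γ) (by omega)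
  obtain ⟨b, hb⟩ := exists_walker_of_pathCount_ne_zero (ω := ω) (γ := γ') (by omega)
  have alone : ∀ c, MetBy ω t a c → c = a := by
    rintro c ⟨s, hs, e⟩
    have hm : pathPrefix t (ω.2 c.1) ∈ meetNbhd γ :=
      mem_meetNbhd.2 ⟨⟨s, Nat.lt_succ_of_le hs⟩, by rw [← ha]; exact e⟩
    have hc : pathPrefix t (ω.2 c.1) = γ := by
      by_contra hne
      exact pathCount_pathPrefix_ne_zero c (hγ.2 _ hm hne)
    exact walker_eq_of_pathCount_eq_one hγ.1 hc ha
  have hab : b = a := by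
    refine Relation.TransGen.head_induction_on (motive := fun c _ => c = a → b = a) (h a b)
      ?_ ?_ rfl
    · rintro c hc rfl; exact alone b hc
    · rintro c d hcd _ ih rfl; exact ih (alone d hcd)
  rw [← ha, ← hb, hab]

variable [MeasurableSpace V] [DiscreteMeasurableSpace V]

theorem snMeasure_acquainted_le (G : SimpleGraph V) [DecidableRel G.Adj] (t : ℕ) :
    snMeasure G {ω | ∀ a b : Walker ω, AcquaintedBy ω t a b} ≤
      ENNReal.ofReal ((countLaw (pathRate G t)).real {c | (isolated meetNbhd c).card ≤ 1}) := by
  rw [ofReal_measureReal, ← map_pathCount_snMeasure,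
    Measure.map_apply (measurable_pathCount t) MeasurableSet.of_discrete]
  exact measure_mono fun ω hω => card_isolated_le_one_of_acquainted hω

end Connectivity

/-! ### Decay of return probabilities on regular graphs -/

section Decay

variable {V : Type*} [Fintype V] [DecidableEq V]

/-- The Dirichlet form identity for a symmetric stochastic matrix. -/
theorem sum_sq_sub_quadratic {V : Type*} [Fintype V] {R : Matrix V V ℝ} (h1 : ∀ x, ∑ y, R x y = 1)
    (hs : ∀ x y, R x y = R y x) (f : V → ℝ) :
    ∑ x, f x ^ 2 - ∑ x, ∑ y, f x * R x y * f y =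
      1 / 2 * ∑ x, ∑ y, R x y * (f x - f y) ^ 2 := by
  have e1 : ∑ x, ∑ y, R x y * f x ^ 2 = ∑ x, f x ^ 2 := by
    refine Finset.sum_congr rfl fun x _ => ?_
    rw [← Finset.sum_mul, h1, one_mul]
  have e2 : ∑ x, ∑ y, R x y * f y ^ 2 = ∑ x, f x ^ 2 := by
    rw [Finset.sum_comm]
    refine Finset.sum_congr rfl fun x _ => ?_
    simp_rw [hs _ x]
    rw [← Finset.sum_mul, h1, one_mul]
  have e3 : ∑ x, ∑ y, R x y * (f x - f y) ^ 2 = ∑ x, ∑ y, R x y * f x ^ 2 +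
      ∑ x, ∑ y, R x y * f y ^ 2 - 2 * ∑ x, ∑ y, f x * R x y * f y := by
    simp_rw [Finset.mul_sum, ← Finset.sum_add_distrib, ← Finset.sum_sub_distrib]
    refine Finset.sum_congr rfl fun x _ => Finset.sum_congr rfl fun y _ => by ring
  rw [e3, e1, e2]; ring

/-- In a connected graph, a function with values in `[0, ∞)` and total mass `1` that attains the
value `M > 2 / |V|` drops by more than `M² / 5` along some edge: otherwise the level sets
`{f ≥ M - j M² / 5}` would grow with `j` until more than `2 / M` vertices have `f ≥ M / 2`. -/
theorem exists_edge_drop {G : SimpleGraph V} (hG : G.Connected) {f : V → ℝ} (hf0 : ∀ x, 0 ≤ f x)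
    (hf1 : ∑ x, f x = 1) {u : V} (hM : 2 < f u * Fintype.card V) :
    ∃ x y, G.Adj x y ∧ f u ^ 2 / 5 < f x - f y := by
  by_contra! hno
  set M := f u with hMdef
  have hM0 : 0 < M := by
    by_contra hle
    have : M = 0 := le_antisymm (not_lt.1 hle) (hf0 u)
    rw [this] at hM; norm_num at hM
  set A : ℕ → Finset V := fun j => Finset.univ.filter fun x => M - j * (M ^ 2 / 5) ≤ f x with hA
  have hhalf : ∀ j : ℕ, j * (M ^ 2 / 5) ≤ M / 2 → ((A j).card : ℝ) * (M / 2) ≤ 1 := by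
    intro j hj
    calc ((A j).card : ℝ) * (M / 2) = ∑ x ∈ A j, M / 2 := by rw [Finset.sum_const, nsmul_eq_mul]
      _ ≤ ∑ x ∈ A j, f x := by
        refine Finset.sum_le_sum fun x hx => ?_
        have := (Finset.mem_filter.1 hx).2
        linarith
      _ ≤ ∑ x, f x := Finset.sum_le_sum_of_subset_of_nonneg (Finset.subset_univ _)
          fun x _ _ => hf0 x
      _ = 1 := hf1
  have grow : ∀ j : ℕ, j * (M ^ 2 / 5) ≤ M / 2 → j + 1 ≤ (A j).card := by
    intro j
    induction j with
    | zero =>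
      intro _
      exact Finset.card_pos.2 ⟨u, by simp [hA, hMdef]⟩
    | succ j ih =>
      intro hj
      have hj' : (j : ℝ) * (M ^ 2 / 5) ≤ M / 2 := by
        push_cast at hj; nlinarith [sq_nonneg M]
      have h1 := ih hj'
      have h2 := hhalf j hj'
      have hne : ∃ w, w ∉ A j := by
        by_contra! hall
        have : (A j).card = Fintype.card V := by
          rw [Finset.eq_univ_iff_forall.2 hall, Finset.card_univ]
        rw [this] at h2
        nlinarith
      obtain ⟨w, hw⟩ := hne
      have hu : u ∈ A j := by
        simp only [hA, Finset.mem_filter, Finset.mem_univ, true_and]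
        nlinarith [sq_nonneg M, (Nat.cast_nonneg j : (0 : ℝ) ≤ j)]
      obtain ⟨p⟩ := hG.preconnected u w
      obtain ⟨d, -, hd1, hd2⟩ := p.exists_boundary_dart (A j : Set V) hu hw
      have hxy := hno _ _ d.adj
      have hsub : insert d.snd (A j) ⊆ A (j + 1) := by
        intro x hx
        simp only [hA, Finset.mem_filter, Finset.mem_univ, true_and, Finset.mem_insert] at hx ⊢
        push_cast
        rcases hx with rfl | hx
        · have : M - j * (M ^ 2 / 5) ≤ f d.fst := by simpa [hA] using hd1
          linarith
        · nlinarith [sq_nonneg M]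
      have := Finset.card_le_card hsub
      rw [Finset.card_insert_of_notMem (by simpa using hd2)] at this
      omega
  -- at the level `j ≈ 2 / M` the two bounds on the level set contradict each other
  set j := ⌊2 / M⌋₊ with hj
  have hj1 : (j : ℝ) ≤ 2 / M := Nat.floor_le (by positivity)
  have hj2 : 2 / M < j + 1 := Nat.lt_floor_add_one _
  have hjM : (j : ℝ) * M ≤ 2 := (le_div_iff₀ hM0).1 hj1
  have hjM2 : 2 < (j + 1 : ℝ) * M := (div_lt_iff₀ hM0).1 hj2
  have hc : (j : ℝ) * (M ^ 2 / 5) ≤ M / 2 := by nlinarith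
  have h1 : ((j : ℝ) + 1) ≤ (A j).card := by exact_mod_cast grow j hc
  have h2 := hhalf j hc
  nlinarith

/-- The energy of a probability vector with a value `M > 2 / |V|`, on a connected regular graph.
If the degree is at least `4 / M`, half of the neighbours of the maximum have values below `M / 2`;
otherwise a single edge on which the vector drops suffices. -/
theorem energy_lower_bound {G : SimpleGraph V} [DecidableRel G.Adj] {d : ℕ} (hG : G.Connected)
    (hd : G.IsRegularOfDegree d) (hd0 : 0 < d) {f : V → ℝ} (hf0 : ∀ x, 0 ≤ f x)
    (hf1 : ∑ x, f x = 1) {u : V} (hM : 2 < f u * Fintype.card V) :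
    f u ^ 5 / 200 ≤ 1 / 2 * ∑ x, ∑ y, lazyWalk G x y * (f x - f y) ^ 2 := by
  set M := f u with hMdef
  have hM0 : 0 < M := by
    by_contra hle
    have : M = 0 := le_antisymm (not_lt.1 hle) (hf0 u)
    rw [this] at hM; norm_num at hM
  have hM1 : M ≤ 1 := hf1 ▸ Finset.single_le_sum (fun x _ => hf0 x) (Finset.mem_univ u)
  have hd0' : (0 : ℝ) < d := by exact_mod_cast hd0
  have hP : ∀ x y, G.Adj x y → lazyWalk G x y = 1 / (2 * (d : ℝ)) := by
    intro x y h
    rw [lazyWalk, if_neg h.ne, if_pos h, hd x]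
  have hnn : ∀ x y, 0 ≤ lazyWalk G x y * (f x - f y) ^ 2 := fun x y =>
    mul_nonneg (lazyWalk_nonneg G x y) (sq_nonneg _)
  rcases le_or_gt (4 / M) d with hdM | hdM
  · have hdM' : 4 ≤ d * M := (div_le_iff₀ hM0).1 hdM
    set B := (G.neighborFinset u).filter fun y => f y ≤ M / 2 with hB
    set B' := (G.neighborFinset u).filter fun y => ¬ f y ≤ M / 2 with hB'
    have hcard : (B.card : ℝ) + B'.card = d := by
      have := Finset.card_filter_add_card_filter_not (s := G.neighborFinset u)
        (fun y => f y ≤ M / 2)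
      rw [G.card_neighborFinset_eq_degree, hd u] at this
      exact_mod_cast this
    have hB'1 : (B'.card : ℝ) * (M / 2) ≤ 1 := by
      calc (B'.card : ℝ) * (M / 2) = ∑ x ∈ B', M / 2 := by rw [Finset.sum_const, nsmul_eq_mul]
        _ ≤ ∑ x ∈ B', f x :=
          Finset.sum_le_sum fun x hx => (not_le.1 (Finset.mem_filter.1 hx).2).le
        _ ≤ ∑ x, f x := Finset.sum_le_sum_of_subset_of_nonneg (Finset.subset_univ _)
          fun x _ _ => hf0 x
        _ = 1 := hf1
    have hBd : (d : ℝ) / 2 ≤ B.card := by nlinarith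
    have h1 : ∑ y ∈ B, 1 / (2 * (d : ℝ)) * (M / 2) ^ 2 ≤
        ∑ x, ∑ y, lazyWalk G x y * (f x - f y) ^ 2 := by
      calc _ ≤ ∑ y ∈ B, lazyWalk G u y * (f u - f y) ^ 2 := by
            refine Finset.sum_le_sum fun y hy => ?_
            have hy' := Finset.mem_filter.1 hy
            rw [hP u y ((G.mem_neighborFinset u y).1 hy'.1)]
            have : M / 2 ≤ f u - f y := by linarith [hy'.2]
            gcongr
        _ ≤ ∑ y, lazyWalk G u y * (f u - f y) ^ 2 :=
            Finset.sum_le_sum_of_subset_of_nonneg (Finset.subset_univ _) fun y _ _ => hnn u y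
        _ ≤ _ := Finset.single_le_sum
            (f := fun x => ∑ y, lazyWalk G x y * (f x - f y) ^ 2)
            (fun x _ => Finset.sum_nonneg fun y _ => hnn x y) (Finset.mem_univ u)
    rw [Finset.sum_const, nsmul_eq_mul] at h1
    have h2 : M ^ 2 / 16 ≤ B.card * (1 / (2 * (d : ℝ)) * (M / 2) ^ 2) := by
      calc M ^ 2 / 16 = (d : ℝ) / 2 * (1 / (2 * (d : ℝ)) * (M / 2) ^ 2) := by field_simp; norm_num
        _ ≤ _ := by gcongr
    have h3 : M ^ 5 ≤ M ^ 2 := pow_le_pow_of_le_one hM0.le hM1 (by norm_num)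
    have h4 := sq_nonneg M
    linarith
  · obtain ⟨x, y, hxy, hdrop⟩ := exists_edge_drop hG hf0 hf1 hM
    have hdM' : d * M < 4 := (lt_div_iff₀ hM0).1 hdM
    have h1 : 1 / (2 * (d : ℝ)) * (M ^ 2 / 5) ^ 2 ≤ lazyWalk G x y * (f x - f y) ^ 2 := by
      rw [hP x y hxy]
      gcongr
    have h1' : 1 / (2 * (d : ℝ)) * (M ^ 2 / 5) ^ 2 ≤ lazyWalk G y x * (f y - f x) ^ 2 := by
      rw [hP y x hxy.symm, ← neg_sub (f x), neg_sq]
      gcongr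
    have h2 : lazyWalk G x y * (f x - f y) ^ 2 + lazyWalk G y x * (f y - f x) ^ 2 ≤
        ∑ x, ∑ y, lazyWalk G x y * (f x - f y) ^ 2 := by
      calc _ ≤ ∑ z ∈ ({x, y} : Finset V), ∑ w, lazyWalk G z w * (f z - f w) ^ 2 := by
            rw [Finset.sum_pair hxy.ne]
            exact add_le_add
              (Finset.single_le_sum (f := fun w => lazyWalk G x w * (f x - f w) ^ 2)
                (fun w _ => hnn x w) (Finset.mem_univ y))
              (Finset.single_le_sum (f := fun w => lazyWalk G y w * (f y - f w) ^ 2)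
                (fun w _ => hnn y w) (Finset.mem_univ x))
        _ ≤ _ := Finset.sum_le_sum_of_subset_of_nonneg (Finset.subset_univ _)
            fun z _ _ => Finset.sum_nonneg fun w _ => hnn z w
    have h3 : M ^ 5 / 200 ≤ 1 / (2 * (d : ℝ)) * (M ^ 2 / 5) ^ 2 := by
      have e : 1 / (2 * (d : ℝ)) * (M ^ 2 / 5) ^ 2 = M ^ 4 / (50 * d) := by field_simp; norm_num
      rw [e, div_le_div_iff₀ (by norm_num) (by positivity)]
      have : M ^ 5 * (50 * d) = M ^ 4 * 50 * (d * M) := by ring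
      rw [this]
      have h4 : 0 < M ^ 4 := by positivity
      nlinarith
    linarith

theorem lazyWalk_symm {G : SimpleGraph V} [DecidableRel G.Adj] {d : ℕ}
    (hd : G.IsRegularOfDegree d) (x y : V) : lazyWalk G x y = lazyWalk G y x := by
  unfold lazyWalk
  simp only [hd x, hd y, eq_comm (a := x) (b := y), G.adj_comm x y]

theorem pow_two_mul_apply_self {P : Matrix V V ℝ} (hs : ∀ x y, P x y = P y x) (i : ℕ) (v : V) :
    (P ^ (2 * i)) v v = ∑ u, (P ^ i) v u ^ 2 := by
  rw [two_mul, pow_add, Matrix.mul_apply]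
  exact Finset.sum_congr rfl fun u _ => by rw [pow_apply_symm hs i u v, sq]

theorem pow_two_mul_succ_apply_self {P : Matrix V V ℝ} (hs : ∀ x y, P x y = P y x) (i : ℕ)
    (v : V) :
    (P ^ (2 * (i + 1))) v v = ∑ x, ∑ y, (P ^ i) v x * (P ^ 2) x y * (P ^ i) v y := by
  have e : 2 * (i + 1) = (i + 2) + i := by ring
  rw [e, pow_add, pow_add, Matrix.mul_apply]
  simp_rw [Matrix.mul_apply, Finset.sum_mul]
  rw [Finset.sum_comm]
  exact Finset.sum_congr rfl fun x _ => Finset.sum_congr rfl fun y _ => by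
    rw [pow_apply_symm hs i y v]

variable {G : SimpleGraph V} [DecidableRel G.Adj] {d : ℕ}

/-- The even return probabilities drop by the energy of the squared walk. -/
theorem return_sub_succ (hd : G.IsRegularOfDegree d) (i : ℕ) (v : V) :
    (lazyWalk G ^ (2 * i)) v v - (lazyWalk G ^ (2 * (i + 1))) v v =
      1 / 2 * ∑ x, ∑ y, (lazyWalk G ^ 2) x y *
        ((lazyWalk G ^ i) v x - (lazyWalk G ^ i) v y) ^ 2 := by
  have hs := lazyWalk_symm hd
  rw [pow_two_mul_apply_self hs, pow_two_mul_succ_apply_self hs]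
  exact sum_sq_sub_quadratic (pow_row_sum (lazyWalk_sum G) 2) (pow_apply_symm hs 2) _

theorem return_antitone (hd : G.IsRegularOfDegree d) (v : V) :
    Antitone fun i => (lazyWalk G ^ (2 * i)) v v := by
  refine antitone_nat_of_succ_le fun i => ?_
  have h := return_sub_succ hd i v
  have : 0 ≤ ∑ x, ∑ y, (lazyWalk G ^ 2) x y *
        ((lazyWalk G ^ i) v x - (lazyWalk G ^ i) v y) ^ 2 :=
    Finset.sum_nonneg fun x _ => Finset.sum_nonneg fun y _ =>
      mul_nonneg (pow_apply_nonneg (lazyWalk_nonneg G) 2 x y) (sq_nonneg _)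
  linarith

theorem return_drop (hG : G.Connected) (hd : G.IsRegularOfDegree d) (hd0 : 0 < d) (i : ℕ) (v : V)
    (ha : 2 < (lazyWalk G ^ (2 * i)) v v * Fintype.card V) :
    (lazyWalk G ^ (2 * i)) v v ^ 5 / 400 ≤
      (lazyWalk G ^ (2 * i)) v v - (lazyWalk G ^ (2 * (i + 1))) v v := by
  have hs := lazyWalk_symm hd
  have h0 := lazyWalk_nonneg G
  set f : V → ℝ := fun x => (lazyWalk G ^ i) v x with hf
  have hf0 : ∀ x, 0 ≤ f x := fun x => pow_apply_nonneg h0 i v x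
  have hf1 : ∑ x, f x = 1 := pow_row_sum (lazyWalk_sum G) i v
  obtain ⟨u, -, hu⟩ := Finset.exists_max_image Finset.univ f ⟨v, Finset.mem_univ v⟩
  -- the return probability is an average of the values of `f`
  have hau : (lazyWalk G ^ (2 * i)) v v ≤ f u := by
    rw [pow_two_mul_apply_self hs]
    calc ∑ x, f x ^ 2 ≤ ∑ x, f x * f u := by
          refine Finset.sum_le_sum fun x hx => ?_
          rw [sq]
          exact mul_le_mul_of_nonneg_left (hu x hx) (hf0 x)
      _ = f u := by rw [← Finset.sum_mul, hf1, one_mul]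
  have ha0 : 0 ≤ (lazyWalk G ^ (2 * i)) v v := pow_apply_nonneg h0 _ v v
  have hM : 2 < f u * Fintype.card V :=
    ha.trans_le (mul_le_mul_of_nonneg_right hau (Nat.cast_nonneg _))
  have h1 := energy_lower_bound hG hd hd0 hf0 hf1 hM
  -- staying put for one of the two steps bounds the squared walk from below
  have hlazy : ∀ x y, 1 / 2 * lazyWalk G x y ≤ (lazyWalk G ^ 2) x y := by
    intro x y
    rw [sq, Matrix.mul_apply]
    have hxx : lazyWalk G x x = 1 / 2 := by
      rw [lazyWalk, if_pos rfl, hd x, if_neg hd0.ne']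
    rw [← hxx]
    exact Finset.single_le_sum (f := fun z => lazyWalk G x z * lazyWalk G z y)
      (fun z _ => mul_nonneg (h0 x z) (h0 z y)) (Finset.mem_univ x)
  have h2 : 1 / 2 * ∑ x, ∑ y, lazyWalk G x y * (f x - f y) ^ 2 ≤
      ∑ x, ∑ y, (lazyWalk G ^ 2) x y * (f x - f y) ^ 2 := by
    simp_rw [Finset.mul_sum]
    refine Finset.sum_le_sum fun x _ => Finset.sum_le_sum fun y _ => ?_
    rw [← mul_assoc]
    exact mul_le_mul_of_nonneg_right (hlazy x y) (sq_nonneg _)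
  rw [return_sub_succ hd]
  have h3 : (lazyWalk G ^ (2 * i)) v v ^ 5 ≤ f u ^ 5 := pow_le_pow_left₀ ha0 hau 5
  linarith

/-- If the average of the return probabilities up to time `m` is at least `2 a`, then the return
probability exceeds `a` for a time of order `m a`, and during all this time it drops by a fixed
amount per step. -/
theorem return_average_bound (hG : G.Connected) (hd : G.IsRegularOfDegree d) (hd0 : 0 < d)
    (v : V) {a : ℝ} (ha0 : 0 ≤ a) (ha : 2 < a * Fintype.card V) {m : ℕ}
    (hsum : 2 * a * m ≤ ∑ i ∈ Finset.range m, (lazyWalk G ^ (2 * i)) v v) :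
    m * a ^ 6 ≤ 400 := by
  set r : ℕ → ℝ := fun i => (lazyWalk G ^ (2 * i)) v v with hr
  have hr0 : ∀ i, 0 ≤ r i := fun i => pow_apply_nonneg (lazyWalk_nonneg G) _ v v
  have hanti : Antitone r := return_antitone hd v
  have hr00 : r 0 = 1 := by simp [hr]
  have hr1 : ∀ i, r i ≤ 1 := fun i => hr00 ▸ hanti (Nat.zero_le i)
  set B := (Finset.range m).filter fun i => a ≤ r i with hB
  have h1 : ∑ i ∈ Finset.range m, r i ≤ B.card + m * a := by
    calc ∑ i ∈ Finset.range m, r i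
        ≤ ∑ i ∈ Finset.range m, ((if a ≤ r i then 1 else 0) + a) := by
          refine Finset.sum_le_sum fun i _ => ?_
          split_ifs with h
          · linarith [hr1 i]
          · linarith [not_le.1 h]
      _ = B.card + m * a := by
          rw [Finset.sum_add_distrib, Finset.sum_boole, Finset.sum_const, Finset.card_range,
            nsmul_eq_mul]
  have h2 : (B.card : ℝ) * (a ^ 5 / 400) ≤ 1 := by
    calc (B.card : ℝ) * (a ^ 5 / 400) = ∑ i ∈ B, a ^ 5 / 400 := by
          rw [Finset.sum_const, nsmul_eq_mul]
      _ ≤ ∑ i ∈ B, (r i - r (i + 1)) := by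
          refine Finset.sum_le_sum fun i hi => ?_
          have hi' := (Finset.mem_filter.1 hi).2
          have hc : 2 < r i * Fintype.card V :=
            ha.trans_le (mul_le_mul_of_nonneg_right hi' (Nat.cast_nonneg _))
          have h := return_drop hG hd hd0 i v hc
          have : a ^ 5 ≤ r i ^ 5 := pow_le_pow_left₀ ha0 hi' 5
          simp only [hr] at this ⊢
          linarith
      _ ≤ ∑ i ∈ Finset.range m, (r i - r (i + 1)) :=
          Finset.sum_le_sum_of_subset_of_nonneg (Finset.filter_subset _ _)
            fun i _ _ => sub_nonneg.2 (hanti (Nat.le_succ i))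
      _ = r 0 - r m := Finset.sum_range_sub' r m
      _ ≤ 1 := by linarith [hr0 m]
  have h3 : m * a ≤ B.card := by linarith
  have h4 : (m * a) * (a ^ 5 / 400) ≤ B.card * (a ^ 5 / 400) := by gcongr
  nlinarith

end Decay

/-! ### Regular graphs -/

section Regular

theorem exists_acquainted_of_connectivityTime_lt {V : Type*} {ω : Config V} {r : ℝ}
    (h : (((socialConnectivityTime ω : ℕ∞) : ENNReal) : EReal) < (r : EReal)) :
    ∃ k : ℕ, (k : ℝ) < r ∧ ∀ a b : Walker ω, AcquaintedBy ω k a b := by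
  by_cases htop : socialConnectivityTime ω = ⊤
  · rw [htop] at h
    simp at h
  · obtain ⟨k, hk⟩ := ENat.ne_top_iff_exists.1 htop
    have hlt : socialConnectivityTime ω < ((k + 1 : ℕ) : ℕ∞) := by
      rw [← hk]; exact_mod_cast Nat.lt_succ_self k
    obtain ⟨t, ht, hacq⟩ := socialConnectivityTime_lt hlt
    have htk : t ≤ k := Nat.lt_succ_iff.1 (by exact_mod_cast ht)
    refine ⟨k, ?_, fun a b => (hacq a b).mono htk⟩
    have e : (((k : ℕ∞) : ENNReal) : EReal) = ((k : ℝ) : EReal) := by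
      rw [ENat.toENNReal_coe, ← ENNReal.ofReal_natCast, EReal.coe_ennreal_ofReal,
        max_eq_left (Nat.cast_nonneg k)]
    rw [← hk, e] at h
    exact EReal.coe_lt_coe_iff.1 h

theorem degree_pos_of_connected {V : Type*} [Fintype V] [Nontrivial V] {G : SimpleGraph V}
    [DecidableRel G.Adj] {d : ℕ} (hG : G.Connected) (hd : G.IsRegularOfDegree d) : 0 < d := by
  obtain ⟨v⟩ := hG.nonempty
  rw [← hd v]
  exact hG.preconnected.degree_pos_of_nontrivial v

theorem meanWalkers_eq_one {V : Type*} [Fintype V] [Nontrivial V] {G : SimpleGraph V}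
    [DecidableRel G.Adj] {d : ℕ} (hG : G.Connected) (hd : G.IsRegularOfDegree d) (v : V) :
    meanWalkers G v = 1 := by
  have hd0 := degree_pos_of_connected hG hd
  have h := G.sum_degrees_eq_twice_card_edges
  simp_rw [hd _, Finset.sum_const, Finset.card_univ, smul_eq_mul] at h
  have h' : (Fintype.card V : ℝ≥0) * d = 2 * (G.edgeFinset.card : ℝ≥0) := by exact_mod_cast h
  have hc : (Fintype.card V : ℝ≥0) ≠ 0 := by exact_mod_cast Fintype.card_ne_zero
  have hd0' : (d : ℝ≥0) ≠ 0 := by exact_mod_cast hd0.ne'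
  rw [meanWalkers, hd v, ← h']
  field_simp

theorem log_card_pos {V : Type*} [Fintype V] [Nontrivial V] :
    0 < Real.log (Fintype.card V) :=
  Real.log_pos (by exact_mod_cast Fintype.one_lt_card)

theorem one_le_kappa {V : Type*} [Fintype V] [DecidableEq V] [Nonempty V] (G : SimpleGraph V)
    [DecidableRel G.Adj] (t : ℕ) : 1 ≤ kappa G t := by
  refine Finset.le_inf' _ _ fun v _ => ?_
  calc (1 : ℝ) = (lazyWalk G ^ (2 * 0)) v v := by simp
    _ ≤ _ := Finset.single_le_sum (f := fun i => (lazyWalk G ^ (2 * i)) v v)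
      (fun i _ => pow_apply_nonneg (lazyWalk_nonneg G) _ v v) (by simp)

variable {V : Type*} [Fintype V] [DecidableEq V] [Nontrivial V]
  {G : SimpleGraph V} [DecidableRel G.Adj] {d : ℕ}

theorem pathRate_eq (hG : G.Connected) (hd : G.IsRegularOfDegree d) (t : ℕ)
    (γ : Fin (t + 1) → V) : (pathRate G t γ : ℝ) = pathWeight (lazyWalk G) γ := by
  rw [pathRate_coe, meanWalkers_eq_one hG hd, NNReal.coe_one, one_mul]

theorem sum_pathRate (hG : G.Connected) (hd : G.IsRegularOfDegree d) (t : ℕ) :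
    ∑ γ, (pathRate G t γ : ℝ) = Fintype.card V := by
  simp_rw [pathRate_eq hG hd]
  exact sum_pathWeight (lazyWalk_sum G) (lazyWalk_symm hd) t

theorem sum_meetNbhd_pathRate_le (hG : G.Connected) (hd : G.IsRegularOfDegree d) {t : ℕ}
    (γ : Fin (t + 1) → V) : ∑ η ∈ meetNbhd γ, (pathRate G t η : ℝ) ≤ t + 1 := by
  simp_rw [pathRate_eq hG hd]
  exact sum_meetNbhd_le (lazyWalk_nonneg G) (lazyWalk_sum G) (lazyWalk_symm hd) γ

/-- Jensen's inequality: an upper bound on the weight of the meeting pairs of paths is a lower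
bound on the mean free mass. -/
theorem le_meanFreeMass (hG : G.Connected) (hd : G.IsRegularOfDegree d) (t : ℕ) {b : ℝ}
    (hb : ∑ γ, (pathRate G t γ : ℝ) * ∑ η ∈ meetNbhd γ, (pathRate G t η : ℝ) ≤
      Fintype.card V * b) :
    Fintype.card V * Real.exp (-b) ≤ meanFreeMass (pathRate G t) meetNbhd := by
  have htangent : ∀ x : ℝ, Real.exp (-b) * (1 + b - x) ≤ Real.exp (-x) := by
    intro x
    have h := Real.add_one_le_exp (b - x)
    calc Real.exp (-b) * (1 + b - x) ≤ Real.exp (-b) * Real.exp (b - x) := by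
          gcongr; linarith
      _ = Real.exp (-x) := by rw [← Real.exp_add]; congr 1; ring
  have hn := sum_pathRate hG hd t
  calc Fintype.card V * Real.exp (-b)
      = Real.exp (-b) * (Fintype.card V * (1 + b) - Fintype.card V * b) := by ring
    _ ≤ Real.exp (-b) * ((∑ γ, (pathRate G t γ : ℝ)) * (1 + b) -
        ∑ γ, (pathRate G t γ : ℝ) * ∑ η ∈ meetNbhd γ, (pathRate G t η : ℝ)) := by
        rw [hn]; gcongr
    _ = ∑ γ, (pathRate G t γ : ℝ) *
        (Real.exp (-b) * (1 + b - ∑ η ∈ meetNbhd γ, (pathRate G t η : ℝ))) := by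
        rw [Finset.sum_mul, ← Finset.sum_sub_distrib, Finset.mul_sum]
        exact Finset.sum_congr rfl fun γ _ => by ring
    _ ≤ _ := by
        unfold meanFreeMass
        gcongr with γ _
        exact htangent _

theorem le_meanFreeMass_time (hG : G.Connected) (hd : G.IsRegularOfDegree d) (t : ℕ) :
    Fintype.card V * Real.exp (-((t : ℝ) + 1)) ≤ meanFreeMass (pathRate G t) meetNbhd := by
  refine le_meanFreeMass hG hd t ?_
  rw [← sum_pathRate hG hd t, Finset.sum_mul]
  exact Finset.sum_le_sum fun γ _ =>
    mul_le_mul_of_nonneg_left (sum_meetNbhd_pathRate_le hG hd γ) (NNReal.coe_nonneg _)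

theorem le_meanFreeMass_kappa (hG : G.Connected) (hd : G.IsRegularOfDegree d) {t : ℕ} {l : ℝ}
    (ht : ((t : ℝ) + 1) / kappa G (t + 1) ≤ l) :
    Fintype.card V * Real.exp (-(2 * l)) ≤ meanFreeMass (pathRate G t) meetNbhd := by
  refine le_meanFreeMass hG hd t ?_
  have hκ : 0 < kappa G (t + 1) := zero_lt_one.trans_le (one_le_kappa G _)
  have h := sum_pathWeight_meetNbhd_le (lazyWalk_nonneg G) (lazyWalk_sum G) (lazyWalk_symm hd)
    hκ.le (r := t + 1) (fun u => Finset.inf'_le _ (Finset.mem_univ u)) t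
  simp_rw [pathRate_eq hG hd]
  have ht' : (t : ℝ) + 1 ≤ l * kappa G (t + 1) := (div_le_iff₀ hκ).1 ht
  refine le_of_mul_le_mul_right (h.trans ?_) hκ
  push_cast
  have hn : (0 : ℝ) ≤ Fintype.card V := Nat.cast_nonneg _
  calc (Fintype.card V : ℝ) * (t + (t + 1) + 1) = Fintype.card V * (2 * (t + 1)) := by ring
    _ ≤ Fintype.card V * (2 * (l * kappa G (t + 1))) := by gcongr
    _ = _ := by ring

/-- Before the time `s_*` the walk has taken only polylogarithmically many steps. -/
theorem time_le_log_pow (hG : G.Connected) (hd : G.IsRegularOfDegree d) {t : ℕ}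
    (ht : ¬ ((t : ℝ) + 1) / kappa G (t + 1) > 1 / 32 * Real.log (Fintype.card V)) :
    (t : ℝ) + 1 ≤ Real.log (Fintype.card V) ^ 6 := by
  set n : ℝ := (Fintype.card V : ℝ) with hn
  set L := Real.log n with hL
  have hL0 : 0 < L := log_card_pos
  have hn0 : 0 < n := by rw [hn]; exact_mod_cast Fintype.card_pos
  have hκ : 0 < kappa G (t + 1) := zero_lt_one.trans_le (one_le_kappa G _)
  have hLn : L < n := by
    have := Real.log_le_sub_one_of_pos hn0
    linarith
  obtain ⟨v⟩ := hG.nonempty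
  have h1 : kappa G (t + 1) ≤ ∑ i ∈ Finset.range (t + 2), (lazyWalk G ^ (2 * i)) v v :=
    Finset.inf'_le _ (Finset.mem_univ v)
  have h2 : (t : ℝ) + 1 ≤ 1 / 32 * L * kappa G (t + 1) := (div_le_iff₀ hκ).1 (not_lt.1 ht)
  have h3 := return_average_bound hG hd (degree_pos_of_connected hG hd) v (a := 8 / L)
    (by positivity) (by rw [div_mul_eq_mul_div, lt_div_iff₀ hL0]; linarith) (m := t + 2) (by
      refine le_trans ?_ h1
      have e : 2 * (8 / L) * ((t + 2 : ℕ) : ℝ) = 16 * (t + 2) / L := by push_cast; ring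
      rw [e, div_le_iff₀ hL0]
      have : (0 : ℝ) ≤ t := Nat.cast_nonneg t
      linarith)
  have h4 : ((t + 2 : ℕ) : ℝ) * 8 ^ 6 ≤ 400 * L ^ 6 := by
    rw [div_pow, mul_div_assoc', div_le_iff₀ (by positivity)] at h3
    exact h3
  push_cast at h4
  have : 0 < L ^ 6 := by positivity
  linarith

theorem exists_time_kappa (hG : G.Connected) (hd : G.IsRegularOfDegree d) :
    ∃ t : ℕ, ((t : ℝ) + 1) / kappa G (t + 1) > 1 / 32 * Real.log (Fintype.card V) := by
  by_contra! hno
  obtain ⟨t, ht⟩ := exists_nat_gt (Real.log (Fintype.card V) ^ 6)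
  have := time_le_log_pow hG hd (t := t) (not_lt.2 (hno t))
  linarith

variable [MeasurableSpace V] [DiscreteMeasurableSpace V]

theorem measure_acquainted_le_time (hG : G.Connected) (hd : G.IsRegularOfDegree d) (t : ℕ) :
    snMeasure G {ω | ∀ a b : Walker ω, AcquaintedBy ω t a b} ≤
      ENNReal.ofReal (40 * ((t : ℝ) + 1) ^ 2 /
        (Fintype.card V * Real.exp (-((t : ℝ) + 1)))) := by
  refine (snMeasure_acquainted_le G t).trans (ENNReal.ofReal_le_ofReal ?_)
  have hn0 : (0 : ℝ) < Fintype.card V := by exact_mod_cast Fintype.card_pos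
  have hμ := le_meanFreeMass_time hG hd t
  have hμ0 : 0 < meanFreeMass (pathRate G t) meetNbhd := lt_of_lt_of_le (by positivity) hμ
  refine (isolated_card_le_one_variance self_mem_meetNbhd mem_meetNbhd_symm (by simp)
    (sum_meetNbhd_pathRate_le hG hd) hμ0).trans ?_
  gcongr

theorem measure_acquainted_le_kappa (hG : G.Connected) (hd : G.IsRegularOfDegree d) {t : ℕ}
    (ht : ¬ ((t : ℝ) + 1) / kappa G (t + 1) > 1 / 32 * Real.log (Fintype.card V)) :
    snMeasure G {ω | ∀ a b : Walker ω, AcquaintedBy ω t a b} ≤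
      ENNReal.ofReal (10 * Real.exp (-((3 / 8) ^ 8 / 40320 / 16 *
        (√(Fintype.card V : ℝ) / Real.log (Fintype.card V) ^ 4)))) := by
  refine (snMeasure_acquainted_le G t).trans (ENNReal.ofReal_le_ofReal ?_)
  have hK := time_le_log_pow hG hd ht
  have hμ := le_meanFreeMass_kappa hG hd (not_lt.1 ht)
  have hL0 : 0 < Real.log (Fintype.card V) := log_card_pos
  have hn0 : (0 : ℝ) < Fintype.card V := by exact_mod_cast Fintype.card_pos
  have hμ0 : 0 < meanFreeMass (pathRate G t) meetNbhd := lt_of_lt_of_le (by positivity) hμ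
  refine (isolated_card_le_one_exp self_mem_meetNbhd mem_meetNbhd_symm (by simp)
    (sum_meetNbhd_pathRate_le hG hd) hμ0 (sum_pathRate hG hd t)).trans ?_
  gcongr
  set μ := meanFreeMass (pathRate G t) meetNbhd
  set n : ℝ := (Fintype.card V : ℝ)
  set L := Real.log n
  have hnL : n = Real.exp L := (Real.exp_log hn0).symm
  have hsqrt : √n = Real.exp (L / 2) := by
    rw [hnL, Real.exp_half]
  have hμ' : Real.exp (15 * L / 16) ≤ μ := by
    refine le_trans (le_of_eq ?_) hμ
    rw [hnL, ← Real.exp_add]; congr 1; ring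
  have hL8 : (3 / 8) ^ 8 / 40320 * L ^ 8 ≤ Real.exp (3 * L / 8) := by
    have h := Real.pow_div_factorial_le_exp (x := 3 * L / 8) (by positivity) 8
    refine le_trans (le_of_eq ?_) h
    norm_num [Nat.factorial]; ring
  calc (3 / 8) ^ 8 / 40320 / 16 * (√n / L ^ 4)
      = ((3 / 8) ^ 8 / 40320 * L ^ 8) * Real.exp (L / 2) / (16 * L ^ 12) := by
        rw [hsqrt]; field_simp
    _ ≤ Real.exp (3 * L / 8) * Real.exp (L / 2) / (16 * L ^ 12) := by gcongr
    _ = Real.exp (15 * L / 16) ^ 2 / (16 * n * (L ^ 6) ^ 2) := by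
        have e1 : Real.exp (15 * L / 16) ^ 2 =
            Real.exp (3 * L / 8) * Real.exp (L / 2) * n := by
          rw [hnL, ← Real.exp_add, ← Real.exp_add, ← Real.exp_nat_mul]
          congr 1; push_cast; ring
        rw [e1]; field_simp
    _ ≤ μ ^ 2 / (16 * n * ((t : ℝ) + 1) ^ 2) := by gcongr

end Regular

end SocialNetwork

end

theorem theorem2 :
    ∃ c C : ℝ, 0 < c ∧ 0 < C ∧
      ∀ (V : Type*) [Fintype V] [DecidableEq V] [Nontrivial V]
        [MeasurableSpace V] [DiscreteMeasurableSpace V]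
        (G : SimpleGraph V) [DecidableRel G.Adj] (d : ℕ),
        G.Connected → G.IsRegularOfDegree d →
          SocialNetwork.snMeasure G
              {ω | (((SocialNetwork.socialConnectivityTime ω : ℕ∞) : ENNReal) : EReal) <
                ((Real.log (Fintype.card V)
                  - 6 * Real.log (Real.log (Fintype.card V)) : ℝ) : EReal)}
            ≤ ENNReal.ofReal (C / Real.log (Fintype.card V)) ∧
          SocialNetwork.snMeasure G
              {ω | SocialNetwork.socialConnectivityTime ω < SocialNetwork.sStar G}
            ≤ ENNReal.ofReal
                (C * Real.exp (-c * (√(Fintype.card V : ℝ) /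
                  Real.log (Fintype.card V) ^ 4))) := by
  refine ⟨(3 / 8) ^ 8 / 40320 / 16, 480, by norm_num, by norm_num, ?_⟩
  intro V _ _ _ _ _ G _ d hG hd
  have hL0 : 0 < Real.log (Fintype.card V) := SocialNetwork.log_card_pos
  have hn0 : (0 : ℝ) < Fintype.card V := by exact_mod_cast Fintype.card_pos
  constructor
  · set L := Real.log (Fintype.card V) with hL
    rcases lt_or_ge L 1 with hL1 | hL1
    · refine prob_le_one.trans ?_
      rw [← ENNReal.ofReal_one]
      refine ENNReal.ofReal_le_ofReal ?_
      rw [le_div_iff₀ hL0]; linarith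
    set r := L - 6 * Real.log L with hr
    rcases le_or_gt r 0 with hr0 | hr0
    · refine le_trans (measure_mono_null ?_ measure_empty).le zero_le
      intro ω hω
      obtain ⟨k, hk, -⟩ := SocialNetwork.exists_acquainted_of_connectivityTime_lt hω
      have : (0 : ℝ) ≤ k := Nat.cast_nonneg k
      exact absurd hk (not_lt.2 (hr0.trans this))
    -- the last integer time before `r`
    set t := ⌈r⌉₊ - 1 with ht
    have hceil : 0 < ⌈r⌉₊ := Nat.ceil_pos.2 hr0
    have htr : (t : ℝ) < r := Nat.lt_ceil.1 (by omega)
    refine (measure_mono ?_).trans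
      ((SocialNetwork.measure_acquainted_le_time hG hd t).trans (ENNReal.ofReal_le_ofReal ?_))
    · intro ω hω a b
      obtain ⟨k, hk, hacq⟩ := SocialNetwork.exists_acquainted_of_connectivityTime_lt hω
      have : k < ⌈r⌉₊ := Nat.lt_ceil.2 hk
      exact (hacq a b).mono (by omega)
    · have hlog : 0 ≤ Real.log L := Real.log_nonneg hL1
      have hK : (t : ℝ) + 1 ≤ 2 * L := by linarith
      have hden : L ^ 6 * Real.exp (-1) ≤
          Fintype.card V * Real.exp (-((t : ℝ) + 1)) := by
        have e1 : (Fintype.card V : ℝ) = Real.exp L := (Real.exp_log hn0).symm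
        have e2 : L ^ 6 = Real.exp (6 * Real.log L) := by
          rw [show (6 : ℝ) * Real.log L = ((6 : ℕ) : ℝ) * Real.log L by norm_num,
            Real.exp_nat_mul, Real.exp_log hL0]
        rw [e1, e2, ← Real.exp_add, ← Real.exp_add]
        exact Real.exp_le_exp.2 (by linarith)
      have he : (1 : ℝ) / 3 ≤ Real.exp (-1) := by
        rw [Real.exp_neg, one_div]
        exact inv_anti₀ (Real.exp_pos 1) (by linarith [Real.exp_one_lt_d9])
      calc 40 * ((t : ℝ) + 1) ^ 2 / (Fintype.card V * Real.exp (-((t : ℝ) + 1)))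
          ≤ 40 * (2 * L) ^ 2 / (L ^ 6 * (1 / 3)) := by
            have : L ^ 6 * (1 / 3) ≤ Fintype.card V * Real.exp (-((t : ℝ) + 1)) :=
              le_trans (by gcongr) hden
            gcongr
        _ = 480 / L ^ 4 := by field_simp; norm_num
        _ ≤ 480 / L := by
            gcongr
            exact le_self_pow₀ hL1 (by norm_num)
  · have hex := SocialNetwork.exists_time_kappa hG hd
    classical
    set T := Nat.find hex with hT
    have hS : SocialNetwork.sStar G ≤ (T : ℕ∞) := sInf_le ⟨T, rfl, Nat.find_spec hex⟩
    rcases Nat.eq_zero_or_pos T with h0 | h0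
    · refine le_trans (measure_mono_null ?_ measure_empty).le zero_le
      intro ω hω
      have : SocialNetwork.socialConnectivityTime ω < (T : ℕ∞) := lt_of_lt_of_le hω hS
      rw [h0] at this
      simp at this
    · have hmin := Nat.find_min hex (m := T - 1) (by omega)
      refine (measure_mono ?_).trans
        ((SocialNetwork.measure_acquainted_le_kappa hG hd hmin).trans
          (ENNReal.ofReal_le_ofReal ?_))
      · intro ω hω a b
        obtain ⟨k, hk, hacq⟩ := SocialNetwork.socialConnectivityTime_lt (lt_of_lt_of_le hω hS)
        have : k < T := by exact_mod_cast hk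
        exact (hacq a b).mono (by omega)
      · rw [neg_mul]
        gcongr
        norm_num
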